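/- Let $\mathbb{D}$ be the unit disk and let $I$ be a non-constant inner function, that is, a non-constant holomorphic function on $\mathbb{D}$ with $|I|\le 1$ whose radial limits exist and have modulus $1$ at almost every point of $\partial\mathbb{D}$. For a holomorphic function $H \not\equiv 0$ on $\mathbb{D}$ in the weighted Bergman space $A^2_1$ (that is, $\int_{\mathbb{D}}|H(z)|^2(1-|z|)\,|dz|^2<\infty$) and $n\in\mathbb{R}$, let $u_{H,n}$ be the solution of $\Delta u=|H|^2e^{2u}$ in $\mathbb{D}$, $u=n$ on $\partial\mathbb{D}$. Here the equation holds in the sense of distributions, with $u$ and $|H|^2e^{2u}$ in $L^1_{\mathrm{loc}}(\mathbb{D})$, and the boundary condition means that the measures $u(re^{i\theta})\,d\theta$ converge weak-$*$ to $n\,d\theta$ as $r\to1^-$; pointwise values of $u_{H,n}$ are those of its continuous representative. The canonical solution is $u_{H,\infty}=\lim_{n\to\infty}u_{H,n}$ (pointwise). A Liouville map of a solution $u$ of $\Delta u=|H|^2e^{2u}$ is a holomorphic map $F:\mathbb{D}\to\mathbb{D}$, with $F'\neq 0$ off the zeros of $H$, such that $u=\log\bigl(\frac{1}{|H|}\frac{2|F'|}{1-|F|^2}\bigr)$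 off the zeros of $H$. Then $I'\in A^2_1\setminus\{0\}$; for every $n\in\mathbb{R}$ the solution $u_{I',n}$ exists, has a continuous representative, and is unique up to almost everywhere equality; $|I|<1$ on $\mathbb{D}$; and the canonical solution of $\Delta u=|I'|^2e^{2u}$ exists, is unique, solves this equation in the sense of distributions, and is $$u_{I',\infty}=\log\frac{2}{1-|I|^2}\quad\text{on }\mathbb{D}.$$ Consequently $I$ is a Liouville map of $u_{I',\infty}$, and every Liouville map of $u_{I',\infty}$ is of the form $\sigma\circ I$ for some conformal automorphism $\sigma$ of $\mathbb{D}$. -/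

import Mathlib

open Set Filter Topology MeasureTheory
open scoped ContDiff

/-- The open unit disk. -/
abbrev unitDisk : Set ℂ := Metric.ball (0 : ℂ) 1

/-- Inner functions: holomorphic functions on the unit disk, bounded by `1`, whose radial limit
at almost every point of the unit circle exists and has modulus `1`. -/
structure IsInnerFunction (I : ℂ → ℂ) : Prop where
  holo : DifferentiableOn ℂ I unitDisk
  norm_le_one : ∀ z ∈ unitDisk, ‖I z‖ ≤ 1
  radial : ∀ᵐ θ : ℝ, ∃ w : ℂ, ‖w‖ = 1 ∧
    Tendsto (fun r : ℝ => I (circleMap 0 r θ)) (𝓝[<] 1) (𝓝 w)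

/-- Membership in the weighted Bergman space `A²₁` of the unit disk. -/
structure MemBergman (H : ℂ → ℂ) : Prop where
  holo : DifferentiableOn ℂ H unitDisk
  integrable : IntegrableOn (fun z => ‖H z‖ ^ 2 * (1 - ‖z‖)) unitDisk

/-- `u` solves the weighted Gauss curvature equation `Δu = |H|² e^{2u}` in the unit disk, in the
sense of distributions. -/
structure IsWeakSolution (H : ℂ → ℂ) (u : ℂ → ℝ) : Prop where
  locallyIntegrable : LocallyIntegrableOn u unitDisk
  locallyIntegrable_rhs :
    LocallyIntegrableOn (fun z => ‖H z‖ ^ 2 * Real.exp (2 * u z)) unitDisk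
  weak_eq : ∀ φ : ℂ → ℝ, ContDiff ℝ ∞ φ → HasCompactSupport φ → tsupport φ ⊆ unitDisk →
    ∫ z in unitDisk, u z * Laplacian.laplacian φ z =
      ∫ z in unitDisk, ‖H z‖ ^ 2 * Real.exp (2 * u z) * φ z

/-- `u = h` on the unit circle: the measures `u(re^{iθ}) dθ` converge weak-* to `h dθ` as
`r → 1⁻`. -/
structure HasBoundaryValues (u h : ℂ → ℝ) : Prop where
  circleIntegrable : ∀ᶠ r : ℝ in 𝓝[<] 1, CircleIntegrable u 0 r
  tendsto : ∀ φ : ℂ → ℝ, ContinuousOn φ (Metric.sphere (0 : ℂ) 1) →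
    Tendsto (fun r : ℝ => ∫ θ in (0 : ℝ)..2 * Real.pi, φ (circleMap 0 1 θ) * u (circleMap 0 r θ))
      (𝓝[<] 1)
      (𝓝 (∫ θ in (0 : ℝ)..2 * Real.pi, φ (circleMap 0 1 θ) * h (circleMap 0 1 θ)))

/-- `u` solves the Dirichlet problem `Δu = |H|² e^{2u}` in the disk, `u = h` on the circle. -/
structure IsDirichletSolution (H : ℂ → ℂ) (h u : ℂ → ℝ) : Prop where
  weak : IsWeakSolution H u
  boundary : HasBoundaryValues u h

/-- `u` is the canonical solution of `Δu = |H|² e^{2u}`: the pointwise limit, as `n → ∞`, of the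
solutions `u_{H,n}` with constant boundary values `n`. Weak solutions are only determined almost
everywhere; for pointwise values each `u_{H,n}` is represented by a continuous function. -/
def IsCanonicalSolution (H : ℂ → ℂ) (u : ℂ → ℝ) : Prop :=
  ∃ U : ℝ → ℂ → ℝ,
    (∀ n : ℝ, ContinuousOn (U n) unitDisk ∧ IsDirichletSolution H (fun _ => n) (U n)) ∧
    ∀ z ∈ unitDisk, Tendsto (fun n => U n z) atTop (𝓝 (u z))

/-- `F` is a Liouville map of the solution `u` of `Δu = |H|² e^{2u}`: a holomorphic self-map of
the unit disk with `u = log ((1 / |H|) * 2 |F'| / (1 - |F|²))` off the zeros of `H`. -/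
structure IsLiouvilleMap (H : ℂ → ℂ) (u : ℂ → ℝ) (F : ℂ → ℂ) : Prop where
  holo : DifferentiableOn ℂ F unitDisk
  mapsTo : MapsTo F unitDisk unitDisk
  deriv_ne_zero : ∀ z ∈ unitDisk, H z ≠ 0 → deriv F z ≠ 0
  eq_log : ∀ z ∈ unitDisk, H z ≠ 0 →
    u z = Real.log (1 / ‖H z‖ * (2 * ‖deriv F z‖ / (1 - ‖F z‖ ^ 2)))

/-- Conformal automorphisms of the unit disk. -/
structure IsDiskAutomorphism (σ : ℂ → ℂ) : Prop where
  holo : DifferentiableOn ℂ σ unitDisk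
  bijOn : BijOn σ unitDisk unitDisk

/-!
For `0 < r ≤ 1` the function `log (2r / (1 - r²|I|²))` (`pullbackSolution I r`) is a smooth solution
of `Δu = |I'|² e^{2u}`: it comes from pulling back the Poincaré metric, of curvature `-1`, under
`rI`. For `r < 1` it is bounded, and since `|I| = 1` radially almost everywhere on the circle,
dominated convergence shows that its boundary values are the constant `log (2r / (1 - r²))`. Solving
`2r / (1 - r²) = e^n` for `r` (`boundaryRadius n`) gives an explicit solution with boundary values
`n`; as `n → ∞`, `r → 1` and the solutions converge to `log (2 / (1 - |I|²))`. Testing the equation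
of one such bounded solution against radial test functions that approximate `1 - |z|²` shows that
`I'` is in the Bergman space (`memBergman_deriv`).

The canonical solution is identified once the Dirichlet problem with constant boundary values has
only one solution (`IsDirichletSolution.ae_eq`). The solutions are mere distributional solutions
with weak-* boundary values, and the proof has two parts.
* A weakly subharmonic function `w` with weak-* boundary values `0` is nonpositive
  (`HasWeakLaplacian.ae_nonpos_of_hasBoundaryValues`). Average the rotations of `w` against the
  kernel `((1 + cos α) / 2) ^ N`. The average is again subharmonic, and since the kernel has finite
  rank on the circle, it tends to `0` uniformly at the boundary. Kato's inequality
  (`HasWeakLaplacian.kato`) makes a smoothed positive part of it subharmonic, and an integrated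
  maximum principle (`setIntegral_ball_le_of_subharmonic`) makes that positive part vanish. The
  kernels concentrate at `0` as `N → ∞`, so `w ≤ 0`. Applied to `v - n`, this bounds every solution
  `v` by its boundary value `n`.
* If `u` and `v` are two solutions then `|v - u| ≤ (n - v) + (n - u)`, where the circular means of
  the right side tend to `0`. As `t ↦ e^{2t}` is increasing, Kato's inequality makes `|v - u|`
  subharmonic, and the integrated maximum principle makes it vanish.

If `F` is another Liouville map, then `|F'| (1 - |I|²) = |I'| (1 - |F|²)` where `I' ≠ 0`. The square
of this identity is a vanishing sum `∑ pⱼ(z) conj (qⱼ(z))` with holomorphic `pⱼ`, `qⱼ`, which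
polarizes to the vanishing of `∑ pⱼ(z) conj (qⱼ(w))` (`sum_mul_conj_eq_zero_of_diagonal`). Read as
an identity in `z` for a fixed `w` with `I'(w) ≠ 0`, it says that the Möbius normalisations of `F`
and `I` that vanish at `w` have proportional derivatives. Hence they agree up to a unimodular
factor, and `F` is an automorphism of the disk composed with `I` (`exists_automorphism_of_norm_eq`).
-/

/-! ### The Laplacian on the complex plane -/

lemma laplacian_eq_fderiv_fderiv (f : ℂ → ℝ) (z : ℂ) :
    Laplacian.laplacian f z = fderiv ℝ (fderiv ℝ f) z 1 1 +
      fderiv ℝ (fderiv ℝ f) z Complex.I Complex.I := by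
  rw [InnerProductSpace.laplacian_eq_iteratedFDeriv_complexPlane]
  simp [iteratedFDeriv_two_apply]

lemma differentiableAt_fderiv_of_contDiffAt {f : ℂ → ℝ} {z : ℂ} (hf : ContDiffAt ℝ 2 f z) :
    DifferentiableAt ℝ (fderiv ℝ f) z :=
  (hf.fderiv_right (m := 1) (by norm_num)).differentiableAt (by norm_num)

lemma fderiv_fderiv_apply_eq {f : ℂ → ℝ} {z : ℂ} (hf : ContDiffAt ℝ 2 f z) (v : ℂ) :
    fderiv ℝ (fderiv ℝ f) z v v = fderiv ℝ (fun x => fderiv ℝ f x v) z v := by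
  have h := (differentiableAt_fderiv_of_contDiffAt hf).hasFDerivAt.clm_apply
    (hasFDerivAt_const v z)
  rw [h.fderiv]
  simp

lemma laplacian_eq_of_contDiffAt {f : ℂ → ℝ} {z : ℂ} (hf : ContDiffAt ℝ 2 f z) :
    Laplacian.laplacian f z = fderiv ℝ (fun x => fderiv ℝ f x 1) z 1 +
      fderiv ℝ (fun x => fderiv ℝ f x Complex.I) z Complex.I := by
  rw [laplacian_eq_fderiv_fderiv, fderiv_fderiv_apply_eq hf, fderiv_fderiv_apply_eq hf]

lemma continuous_laplacian {f : ℂ → ℝ} (hf : ContDiff ℝ 2 f) :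
    Continuous (Laplacian.laplacian f) := by
  have h1 : Continuous (fderiv ℝ (fderiv ℝ f)) :=
    (hf.fderiv_right (m := 1) (by norm_num)).continuous_fderiv (by norm_num)
  have : Laplacian.laplacian f = fun z => fderiv ℝ (fderiv ℝ f) z 1 1 +
      fderiv ℝ (fderiv ℝ f) z Complex.I Complex.I := by
    ext z; exact laplacian_eq_fderiv_fderiv f z
  rw [this]
  fun_prop

lemma laplacian_eq_zero_of_notMem_tsupport {f : ℂ → ℝ} {z : ℂ} (hz : z ∉ tsupport f) :
    Laplacian.laplacian f z = 0 := by
  have h : f =ᶠ[𝓝 z] fun _ => (0 : ℝ) := notMem_tsupport_iff_eventuallyEq.mp hz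
  have := (InnerProductSpace.laplacian_congr_nhds h).eq_of_nhds
  rw [this]
  simp

/-- Chain rule for the Laplacian: `Δ(J ∘ w) = J'(w) Δw + J''(w) |∇w|²`. -/
lemma laplacian_comp_real {J J' : ℝ → ℝ} {a : ℝ} {w : ℂ → ℝ} {z : ℂ} (hw : ContDiffAt ℝ 2 w z)
    (hJ : ∀ᶠ t in 𝓝 (w z), HasDerivAt J (J' t) t) (hJ' : HasDerivAt J' a (w z)) :
    Laplacian.laplacian (fun x => J (w x)) z = J' (w z) * Laplacian.laplacian w z +
      a * ((fderiv ℝ w z 1) ^ 2 + (fderiv ℝ w z Complex.I) ^ 2) := by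
  have h1 : fderiv ℝ (fun x => J (w x)) =ᶠ[𝓝 z] fun x => J' (w x) • fderiv ℝ w x := by
    have hd : ∀ᶠ x in 𝓝 z, DifferentiableAt ℝ w x := by
      filter_upwards [hw.eventually (by simp)] with x hx
      exact hx.differentiableAt (by norm_num)
    filter_upwards [hd, hw.continuousAt.eventually hJ] with x hx hx2
    exact (hx2.comp_hasFDerivAt x hx.hasFDerivAt).fderiv
  have h2 : HasFDerivAt (fun x => J' (w x) • fderiv ℝ w x)
      (J' (w z) • fderiv ℝ (fderiv ℝ w) z + (a • fderiv ℝ w z).smulRight (fderiv ℝ w z)) z :=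
    (hJ'.comp_hasFDerivAt z (hw.differentiableAt (by norm_num)).hasFDerivAt).smul
      (differentiableAt_fderiv_of_contDiffAt hw).hasFDerivAt
  rw [laplacian_eq_fderiv_fderiv, laplacian_eq_fderiv_fderiv, h1.fderiv_eq, h2.fderiv]
  simp
  ring

lemma fderiv_norm_sq_comp_apply {f : ℂ → ℂ} {z : ℂ} (hf : DifferentiableAt ℂ f z) (v : ℂ) :
    fderiv ℝ (fun x => ‖f x‖ ^ 2) z v = 2 * inner ℝ (f z) (deriv f z * v) := by
  have h := (hf.hasDerivAt.hasFDerivAt.restrictScalars ℝ).norm_sq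
  rw [h.fderiv]
  simp [mul_comm]
  ring

lemma contDiffAt_of_differentiableOn {f : ℂ → ℂ} {s : Set ℂ} (hs : IsOpen s)
    (hf : DifferentiableOn ℂ f s) {z : ℂ} (hz : z ∈ s) {n : WithTop ℕ∞} : ContDiffAt ℝ n f z :=
  (((hf.contDiffOn (n := n) hs).contDiffAt (hs.mem_nhds hz))).restrict_scalars ℝ

lemma fderiv_norm_sq_sq_add {f : ℂ → ℂ} {z : ℂ} (hf : DifferentiableAt ℂ f z) :
    (fderiv ℝ (fun x => ‖f x‖ ^ 2) z 1) ^ 2 + (fderiv ℝ (fun x => ‖f x‖ ^ 2) z Complex.I) ^ 2 =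
      4 * ‖f z‖ ^ 2 * ‖deriv f z‖ ^ 2 := by
  rw [fderiv_norm_sq_comp_apply hf, fderiv_norm_sq_comp_apply hf, Complex.sq_norm, Complex.sq_norm]
  simp [Complex.inner, Complex.normSq_apply]
  ring

/-- `Δ|f|² = 4|f'|²` for holomorphic `f`. -/
lemma laplacian_norm_sq {f : ℂ → ℂ} {s : Set ℂ} (hs : IsOpen s)
    (hf : DifferentiableOn ℂ f s) {z : ℂ} (hz : z ∈ s) :
    Laplacian.laplacian (fun x => ‖f x‖ ^ 2) z = 4 * ‖deriv f z‖ ^ 2 := by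
  have hc : ContDiffAt ℝ 2 (fun x => ‖f x‖ ^ 2) z :=
    (contDiffAt_of_differentiableOn hs hf hz).norm_sq ℝ
  have hd : DifferentiableAt ℂ f z := hf.differentiableAt (hs.mem_nhds hz)
  have hd' : DifferentiableAt ℂ (deriv f) z :=
    (hf.deriv hs).differentiableAt (hs.mem_nhds hz)
  have key : ∀ v : ℂ, fderiv ℝ (fun x => fderiv ℝ (fun x => ‖f x‖ ^ 2) x v) z v =
      2 * (inner ℝ (f z) (deriv (deriv f) z * v * v) +
        inner ℝ (deriv f z * v) (deriv f z * v)) := by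
    intro v
    have h1 : (fun x => fderiv ℝ (fun x => ‖f x‖ ^ 2) x v) =ᶠ[𝓝 z]
        fun x => 2 * inner ℝ (f x) (deriv f x * v) := by
      filter_upwards [hs.mem_nhds hz] with x hx
      exact fderiv_norm_sq_comp_apply (hf.differentiableAt (hs.mem_nhds hx)) v
    have h2 := ((hd.hasDerivAt.hasFDerivAt.restrictScalars ℝ).inner ℝ
      ((hd'.hasDerivAt.mul_const v).hasFDerivAt.restrictScalars ℝ)).const_mul 2
    rw [h1.fderiv_eq, h2.fderiv]
    simp [mul_comm, mul_assoc]
  rw [laplacian_eq_of_contDiffAt hc, key, key, Complex.sq_norm (deriv f z)]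
  simp only [Complex.inner]
  simp [Complex.normSq_apply]
  ring

lemma tsupport_laplacian_subset (f : ℂ → ℝ) :
    tsupport (Laplacian.laplacian f) ⊆ tsupport f :=
  closure_minimal (fun z hz => by
    by_contra hh
    exact hz (laplacian_eq_zero_of_notMem_tsupport hh)) (isClosed_tsupport f)

/-! ### Test functions and weak Laplacians -/

/-- Test functions on the unit disk: smooth, with compact support inside the disk. -/
structure IsTestFunction (φ : ℂ → ℝ) : Prop where
  contDiff : ContDiff ℝ ∞ φ
  hasCompactSupport : HasCompactSupport φ
  tsupport_subset : tsupport φ ⊆ unitDisk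

namespace IsTestFunction

variable {φ : ℂ → ℝ}

lemma continuous (h : IsTestFunction φ) : Continuous φ := h.contDiff.continuous

lemma contDiff_two (h : IsTestFunction φ) : ContDiff ℝ 2 φ := h.contDiff.of_le (by norm_cast)

lemma continuous_laplacian (h : IsTestFunction φ) : Continuous (Laplacian.laplacian φ) :=
  _root_.continuous_laplacian h.contDiff_two

lemma exists_radius (h : IsTestFunction φ) :
    ∃ ρ : ℝ, 0 < ρ ∧ ρ < 1 ∧ tsupport φ ⊆ Metric.closedBall 0 ρ := by
  obtain ⟨ρ, ⟨h0, h1⟩, h2⟩ := exists_pos_lt_subset_ball one_pos (isClosed_tsupport φ)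
    h.tsupport_subset
  exact ⟨ρ, h0, h1, h2.trans Metric.ball_subset_closedBall⟩

lemma eq_zero {z : ℂ} (h : IsTestFunction φ) (hz : z ∉ unitDisk) : φ z = 0 :=
  image_eq_zero_of_notMem_tsupport fun hh => hz (h.tsupport_subset hh)

lemma laplacian_eq_zero {z : ℂ} (h : IsTestFunction φ) (hz : z ∉ unitDisk) :
    Laplacian.laplacian φ z = 0 :=
  laplacian_eq_zero_of_notMem_tsupport fun hh => hz (h.tsupport_subset hh)

lemma hasCompactSupport_laplacian (h : IsTestFunction φ) :
    HasCompactSupport (Laplacian.laplacian φ) :=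
  HasCompactSupport.of_support_subset_isCompact h.hasCompactSupport fun z hz => by
    by_contra hh
    exact hz (laplacian_eq_zero_of_notMem_tsupport hh)

lemma setIntegral_mul_eq (h : IsTestFunction φ) (F : ℂ → ℝ) :
    ∫ z in unitDisk, F z * φ z = ∫ z, F z * φ z :=
  setIntegral_eq_integral_of_forall_compl_eq_zero fun z hz => by simp [h.eq_zero hz]

lemma setIntegral_mul_laplacian_eq (h : IsTestFunction φ) (F : ℂ → ℝ) :
    ∫ z in unitDisk, F z * Laplacian.laplacian φ z = ∫ z, F z * Laplacian.laplacian φ z :=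
  setIntegral_eq_integral_of_forall_compl_eq_zero fun z hz => by simp [h.laplacian_eq_zero hz]

end IsTestFunction

/-- A locally integrable function times a continuous function with compact support in the disk
is integrable. -/
lemma LocallyIntegrableOn.integrable_mul_of_tsupport_subset {F φ : ℂ → ℝ}
    (hF : LocallyIntegrableOn F unitDisk) (hφ : Continuous φ) (hc : HasCompactSupport φ)
    (hs : tsupport φ ⊆ unitDisk) : Integrable (fun z => F z * φ z) := by
  have h1 : IntegrableOn F (tsupport φ) := hF.integrableOn_compact_subset hs hc
  have h2 : IntegrableOn (fun z => F z * φ z) (tsupport φ) :=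
    h1.mul_continuousOn hφ.continuousOn hc
  rw [← integrableOn_iff_integrable_of_support_subset (s := tsupport φ)]
  · exact h2
  · exact (Function.support_mul_subset_right _ _).trans (subset_tsupport φ)

lemma LocallyIntegrableOn.integrable_indicator_closedBall {v : ℂ → ℝ}
    (hv : LocallyIntegrableOn v unitDisk) {ρ : ℝ} (hρ : ρ < 1) :
    Integrable ((Metric.closedBall 0 ρ).indicator v) := by
  rw [integrable_indicator_iff Metric.isClosed_closedBall.measurableSet]
  exact hv.integrableOn_compact_subset (Metric.closedBall_subset_ball hρ)
    (isCompact_closedBall _ _)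

lemma IsTestFunction.integrable_mul {F φ : ℂ → ℝ} (h : IsTestFunction φ)
    (hF : LocallyIntegrableOn F unitDisk) : Integrable (fun z => F z * φ z) :=
  LocallyIntegrableOn.integrable_mul_of_tsupport_subset hF h.continuous h.hasCompactSupport
    h.tsupport_subset

lemma IsTestFunction.integrable_mul_laplacian {F φ : ℂ → ℝ} (h : IsTestFunction φ)
    (hF : LocallyIntegrableOn F unitDisk) :
    Integrable (fun z => F z * Laplacian.laplacian φ z) :=
  LocallyIntegrableOn.integrable_mul_of_tsupport_subset hF h.continuous_laplacian
    h.hasCompactSupport_laplacian ((tsupport_laplacian_subset φ).trans h.tsupport_subset)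

/-- `Δw = f` in the unit disk in the sense of distributions, both functions being locally
integrable. -/
structure HasWeakLaplacian (w f : ℂ → ℝ) : Prop where
  left : LocallyIntegrableOn w unitDisk
  right : LocallyIntegrableOn f unitDisk
  weak_eq : ∀ φ : ℂ → ℝ, IsTestFunction φ →
    ∫ z, w z * Laplacian.laplacian φ z = ∫ z, f z * φ z

lemma isWeakSolution_iff {H : ℂ → ℂ} {u : ℂ → ℝ} :
    IsWeakSolution H u ↔ HasWeakLaplacian u (fun z => ‖H z‖ ^ 2 * Real.exp (2 * u z)) := by
  constructor
  · rintro ⟨h1, h2, h3⟩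
    refine ⟨h1, h2, fun φ hφ => ?_⟩
    have := h3 φ hφ.contDiff hφ.hasCompactSupport hφ.tsupport_subset
    rw [hφ.setIntegral_mul_laplacian_eq] at this
    rw [this]
    exact hφ.setIntegral_mul_eq _
  · rintro ⟨h1, h2, h3⟩
    refine ⟨h1, h2, fun φ a b c => ?_⟩
    have hφ : IsTestFunction φ := ⟨a, b, c⟩
    rw [hφ.setIntegral_mul_laplacian_eq, h3 φ hφ]
    exact (hφ.setIntegral_mul_eq _).symm

lemma HasWeakLaplacian.sub {w₁ w₂ f₁ f₂ : ℂ → ℝ} (h₁ : HasWeakLaplacian w₁ f₁)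
    (h₂ : HasWeakLaplacian w₂ f₂) :
    HasWeakLaplacian (fun z => w₁ z - w₂ z) (fun z => f₁ z - f₂ z) := by
  refine ⟨h₁.left.sub h₂.left, h₁.right.sub h₂.right, fun φ hφ => ?_⟩
  simp only [sub_mul]
  rw [integral_sub (hφ.integrable_mul_laplacian h₁.left) (hφ.integrable_mul_laplacian h₂.left),
    integral_sub (hφ.integrable_mul h₁.right) (hφ.integrable_mul h₂.right), h₁.weak_eq φ hφ,
    h₂.weak_eq φ hφ]

/-- Green's identity on the plane for a `C²` function and a compactly supported one. -/
lemma integral_mul_laplacian_eq {F φ : ℂ → ℝ} (hF : ContDiff ℝ 2 F) (hφ : ContDiff ℝ 2 φ)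
    (hc : HasCompactSupport φ) :
    ∫ z, F z * Laplacian.laplacian φ z = ∫ z, Laplacian.laplacian F z * φ z := by
  have hF1 : ∀ v, ContDiff ℝ 1 (fun x => fderiv ℝ F x v) := fun v =>
    (hF.fderiv_right (m := 1) (by norm_num)).clm_apply contDiff_const
  have hφ1 : ∀ v, ContDiff ℝ 1 (fun x => fderiv ℝ φ x v) := fun v =>
    (hφ.fderiv_right (m := 1) (by norm_num)).clm_apply contDiff_const
  have hF2 : ∀ v, Continuous (fun x => fderiv ℝ (fun x => fderiv ℝ F x v) x v) := fun v =>
    ((hF1 v).continuous_fderiv (by norm_num)).clm_apply continuous_const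
  have hφ2 : ∀ v, Continuous (fun x => fderiv ℝ (fun x => fderiv ℝ φ x v) x v) := fun v =>
    ((hφ1 v).continuous_fderiv (by norm_num)).clm_apply continuous_const
  have hc1 : ∀ v, HasCompactSupport (fun x => fderiv ℝ φ x v) := fun v =>
    hc.fderiv_apply (𝕜 := ℝ) v
  have hc2 : ∀ v, HasCompactSupport (fun x => fderiv ℝ (fun x => fderiv ℝ φ x v) x v) := fun v =>
    (hc1 v).fderiv_apply (𝕜 := ℝ) v
  have i1 : ∀ v, Integrable (fun x => F x * fderiv ℝ (fun x => fderiv ℝ φ x v) x v) := fun v =>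
    (hF.continuous.mul (hφ2 v)).integrable_of_hasCompactSupport ((hc2 v).mul_left)
  have i2 : ∀ v, Integrable (fun x => fderiv ℝ (fun x => fderiv ℝ F x v) x v * φ x) := fun v =>
    ((hF2 v).mul hφ.continuous).integrable_of_hasCompactSupport hc.mul_left
  have i3 : ∀ v, Integrable (fun x => fderiv ℝ F x v * fderiv ℝ φ x v) := fun v =>
    ((hF1 v).continuous.mul (hφ1 v).continuous).integrable_of_hasCompactSupport ((hc1 v).mul_left)
  have i4 : ∀ v, Integrable (fun x => F x * fderiv ℝ φ x v) := fun v =>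
    (hF.continuous.mul (hφ1 v).continuous).integrable_of_hasCompactSupport ((hc1 v).mul_left)
  have i5 : ∀ v, Integrable (fun x => fderiv ℝ F x v * φ x) := fun v =>
    ((hF1 v).continuous.mul hφ.continuous).integrable_of_hasCompactSupport hc.mul_left
  have key : ∀ v, ∫ x, F x * fderiv ℝ (fun x => fderiv ℝ φ x v) x v =
      ∫ x, fderiv ℝ (fun x => fderiv ℝ F x v) x v * φ x := by
    intro v
    rw [integral_mul_fderiv_eq_neg_fderiv_mul_of_integrable (i3 v) (i1 v) (i4 v)
        (fun x _ => hF.differentiable (by norm_num) x)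
        (fun x _ => (hφ1 v).differentiable (by norm_num) x),
      integral_mul_fderiv_eq_neg_fderiv_mul_of_integrable (i2 v) (i3 v) (i5 v)
        (fun x _ => (hF1 v).differentiable (by norm_num) x)
        (fun x _ => hφ.differentiable (by norm_num) x), neg_neg]
  calc ∫ z, F z * Laplacian.laplacian φ z
      = ∫ z, (F z * fderiv ℝ (fun x => fderiv ℝ φ x 1) z 1 +
          F z * fderiv ℝ (fun x => fderiv ℝ φ x Complex.I) z Complex.I) := by
        congr 1; ext z; rw [laplacian_eq_of_contDiffAt hφ.contDiffAt, mul_add]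
    _ = ∫ z, (fderiv ℝ (fun x => fderiv ℝ F x 1) z 1 * φ z +
          fderiv ℝ (fun x => fderiv ℝ F x Complex.I) z Complex.I * φ z) := by
        rw [integral_add (i1 _) (i1 _), integral_add (i2 _) (i2 _), key, key]
    _ = ∫ z, Laplacian.laplacian F z * φ z := by
        congr 1; ext z; rw [laplacian_eq_of_contDiffAt hF.contDiffAt, add_mul]

/-- A function that is `C²` on the disk has its classical Laplacian as weak Laplacian. -/
lemma ContDiffOn.hasWeakLaplacian {u f : ℂ → ℝ} (hu : ContDiffOn ℝ 2 u unitDisk)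
    (hf : ContinuousOn f unitDisk) (huf : ∀ z ∈ unitDisk, Laplacian.laplacian u z = f z) :
    HasWeakLaplacian u f := by
  refine ⟨hu.continuousOn.locallyIntegrableOn measurableSet_ball,
    hf.locallyIntegrableOn measurableSet_ball, fun φ hφ => ?_⟩
  obtain ⟨ρ, h0, h1, h2⟩ := hφ.exists_radius
  -- Multiply `u` by a cutoff function that is `1` near the support of `φ`.
  let χ : ContDiffBump (0 : ℂ) := ⟨(2 * ρ + 1) / 3, (ρ + 2) / 3, by linarith, by linarith⟩
  have hrOut : χ.rOut = (ρ + 2) / 3 := rfl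
  have hrIn : χ.rIn = (2 * ρ + 1) / 3 := rfl
  set F : ℂ → ℝ := fun z => χ z * u z with hFdef
  have hF : ContDiff ℝ 2 F := by
    rw [contDiff_iff_contDiffAt]
    intro z
    by_cases hz : z ∈ unitDisk
    · exact χ.contDiff.contDiffAt.mul (hu.contDiffAt (Metric.isOpen_ball.mem_nhds hz))
    · have hz' : z ∉ tsupport χ := by
        rw [χ.tsupport_eq]
        intro h
        apply hz
        rw [Metric.mem_closedBall, hrOut] at h
        rw [Metric.mem_ball]
        linarith
      have : F =ᶠ[𝓝 z] fun _ => 0 := by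
        filter_upwards [notMem_tsupport_iff_eventuallyEq.mp hz'] with x hx
        simp [hFdef, hx]
      exact contDiffAt_const.congr_of_eventuallyEq this
  have hFu : ∀ z ∈ tsupport φ, F =ᶠ[𝓝 z] u := by
    intro z hz
    have hz' : z ∈ Metric.ball (0 : ℂ) χ.rIn := by
      have := h2 hz
      rw [Metric.mem_closedBall] at this
      rw [Metric.mem_ball, hrIn]
      linarith
    filter_upwards [Metric.isOpen_ball.mem_nhds hz'] with x hx
    simp [hFdef, χ.one_of_mem_closedBall (Metric.ball_subset_closedBall hx)]
  have := integral_mul_laplacian_eq hF hφ.contDiff_two hφ.hasCompactSupport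
  calc ∫ z, u z * Laplacian.laplacian φ z = ∫ z, F z * Laplacian.laplacian φ z := by
        congr 1; ext z
        by_cases hz : z ∈ tsupport φ
        · rw [(hFu z hz).eq_of_nhds]
        · simp [laplacian_eq_zero_of_notMem_tsupport hz]
    _ = ∫ z, Laplacian.laplacian F z * φ z := this
    _ = ∫ z, f z * φ z := by
        congr 1; ext z
        by_cases hz : z ∈ tsupport φ
        · rw [(InnerProductSpace.laplacian_congr_nhds (hFu z hz)).eq_of_nhds,
            huf z (hφ.tsupport_subset hz)]
        · simp [image_eq_zero_of_notMem_tsupport hz]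

/-- The Laplacian commutes with rotations. -/
lemma laplacian_comp_mul_of_norm_eq_one {φ : ℂ → ℝ} (hφ : ContDiff ℝ 2 φ) {c : ℂ} (hc : ‖c‖ = 1)
    (z : ℂ) : Laplacian.laplacian (fun x => φ (c * x)) z = Laplacian.laplacian φ (c * z) := by
  have h1 : ∀ v, (fun x => fderiv ℝ (fun x => φ (c * x)) x v) =
      fun x => fderiv ℝ φ (c * x) (c * v) := by
    intro v; ext x
    have h := ((hφ.differentiable (by norm_num) (c * x)).hasFDerivAt).comp x
      ((hasFDerivAt_id (𝕜 := ℝ) x).const_mul c)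
    have h' : fderiv ℝ (fun x => φ (c * x)) x = _ := h.fderiv
    rw [h']; simp
  have h2 : ∀ v, fderiv ℝ (fun x => fderiv ℝ (fun x => φ (c * x)) x v) z v =
      fderiv ℝ (fderiv ℝ φ) (c * z) (c * v) (c * v) := by
    intro v
    rw [h1]
    have hd := (differentiableAt_fderiv_of_contDiffAt (z := c * z) hφ.contDiffAt).hasFDerivAt.comp z
      ((hasFDerivAt_id (𝕜 := ℝ) z).const_mul c)
    have hd' := hd.clm_apply (hasFDerivAt_const (c * v) z)
    simp only [Function.comp_def] at hd'
    rw [hd'.fderiv]; simp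
  have hcd : ContDiff ℝ 2 (fun x => φ (c * x)) := hφ.comp (contDiff_const.mul contDiff_id)
  -- `c, cI` is another orthonormal basis; expand in the basis `1, I`.
  rw [laplacian_eq_of_contDiffAt hcd.contDiffAt, h2, h2, laplacian_eq_fderiv_fderiv]
  set B := fderiv ℝ (fderiv ℝ φ) (c * z)
  have e : ∀ x y : ℝ, (x : ℂ) + y * Complex.I = x • (1 : ℂ) + y • Complex.I := by
    intro x y; simp
  have ec : c * 1 = c.re • (1 : ℂ) + c.im • Complex.I := by
    rw [← e, Complex.re_add_im, mul_one]
  have ec' : c * Complex.I = (-c.im) • (1 : ℂ) + c.re • Complex.I := by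
    apply Complex.ext <;> simp
  have hn : c.re ^ 2 + c.im ^ 2 = 1 := by
    have := Complex.sq_norm c
    rw [hc, Complex.normSq_apply] at this
    nlinarith
  rw [ec, ec']
  simp only [map_add, map_smul, add_apply, smul_apply,
    smul_eq_mul]
  linear_combination (B 1 1 + B Complex.I Complex.I) * hn

/-! ### Mollification -/

/-- A smooth bump at the origin of radius `1 / (m + 1)`. -/
noncomputable def originBump (m : ℕ) : ContDiffBump (0 : ℂ) where
  rIn := 1 / (2 * ((m : ℝ) + 1))
  rOut := 1 / ((m : ℝ) + 1)
  rIn_pos := by positivity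
  rIn_lt_rOut := by
    apply one_div_lt_one_div_of_lt
    · positivity
    · have : (0 : ℝ) ≤ m := by positivity
      linarith

/-- Mollification of `w`: the convolution with the normalised bump of radius `1 / (m + 1)`. -/
noncomputable def mollify (m : ℕ) (w : ℂ → ℝ) : ℂ → ℝ :=
  convolution ((originBump m).normed volume) w (ContinuousLinearMap.lsmul ℝ ℝ) volume

lemma tendsto_originBump_rOut : Tendsto (fun m => (originBump m).rOut) atTop (𝓝 0) :=
  tendsto_one_div_add_atTop_nhds_zero_nat

lemma mollify_apply (m : ℕ) (w : ℂ → ℝ) (z : ℂ) :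
    mollify m w z = ∫ x, (originBump m).normed volume (z - x) * w x := by
  rw [mollify, convolution_eq_swap]; rfl

lemma contDiff_mollify (m : ℕ) {w : ℂ → ℝ} (hw : LocallyIntegrable w) :
    ContDiff ℝ ∞ (mollify m w) :=
  (originBump m).hasCompactSupport_normed.contDiff_convolution_left _
    (originBump m).contDiff_normed hw

lemma integrable_mollify (m : ℕ) {w : ℂ → ℝ} (hw : Integrable w) : Integrable (mollify m w) :=
  Integrable.integrable_convolution _ (originBump m).integrable_normed hw

lemma tendsto_mollify_ae {w : ℂ → ℝ} (hw : LocallyIntegrable w) :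
    ∀ᵐ z, Tendsto (fun m => mollify m w z) atTop (𝓝 (w z)) := by
  apply ContDiffBump.ae_convolution_tendsto_right_of_locallyIntegrable (K := 2)
    tendsto_originBump_rOut _ hw
  refine Eventually.of_forall fun m => le_of_eq ?_
  simp only [originBump]
  field_simp

lemma mollify_sub (m : ℕ) {w g : ℂ → ℝ} (hw : LocallyIntegrable w) (hg : LocallyIntegrable g)
    (z : ℂ) : mollify m (fun x => w x - g x) z = mollify m w z - mollify m g z := by
  have h : ∀ {u : ℂ → ℝ}, LocallyIntegrable u →
      Integrable (fun x => (originBump m).normed volume (z - x) * u x) := by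
    intro u hu
    have := ((originBump m).hasCompactSupport_normed (μ := volume)).convolutionExists_left
      (ContinuousLinearMap.lsmul ℝ ℝ) (originBump m).continuous_normed hu z
    have h2 := this.integrable_swap
    simpa using h2
  simp only [mollify_apply, mul_sub]
  exact integral_sub (h hw) (h hg)

/-- Mollification is a contraction of `L¹`. -/
lemma integral_abs_mollify_le (m : ℕ) {w : ℂ → ℝ} (hw : Integrable w) :
    ∫ z, |mollify m w z| ≤ ∫ z, |w z| := by
  have h1 : ∀ z, |mollify m w z| ≤ mollify m (fun x => |w x|) z := by
    intro z
    rw [mollify_apply, mollify_apply]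
    refine (abs_integral_le_integral_abs).trans (le_of_eq ?_)
    congr 1; ext x
    rw [abs_mul, abs_of_nonneg ((originBump m).nonneg_normed _)]
  calc ∫ z, |mollify m w z| ≤ ∫ z, mollify m (fun x => |w x|) z :=
        integral_mono (integrable_mollify m hw).abs (integrable_mollify m hw.abs) h1
    _ = ∫ z, |w z| := by
        rw [mollify, integral_convolution _ (originBump m).integrable_normed hw.abs,
          (originBump m).integral_normed]
        simp

lemma tendsto_integral_abs_mollify_sub_of_continuous {g : ℂ → ℝ} (hg : Continuous g)
    (hc : HasCompactSupport g) :
    Tendsto (fun m => ∫ z, |mollify m g z - g z|) atTop (𝓝 0) := by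
  obtain ⟨C, hC⟩ := hg.bounded_above_of_compact_support hc
  obtain ⟨R, hR⟩ := hc.isCompact.isBounded.subset_closedBall (0 : ℂ)
  have hig : Integrable g := hg.integrable_of_hasCompactSupport hc
  have hr1 : ∀ m, (originBump m).rOut ≤ 1 := by
    intro m
    simp only [originBump]
    rw [div_le_one (by positivity)]
    have : (0 : ℝ) ≤ m := by positivity
    linarith
  have hbd : ∀ m z, ‖|mollify m g z - g z|‖ ≤
      (Metric.closedBall (0 : ℂ) (R + 1)).indicator (fun _ => 2 * C) z := by
    intro m z
    rw [Real.norm_eq_abs, abs_abs]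
    have hconst : mollify m (fun _ => C) z = C := by
      rw [mollify_apply]
      rw [integral_mul_const, integral_sub_left_eq_self (fun x => (originBump m).normed volume x),
        (originBump m).integral_normed, one_mul]
    by_cases hz : z ∈ Metric.closedBall (0 : ℂ) (R + 1)
    · rw [indicator_of_mem hz]
      have h1 : |mollify m g z| ≤ C := by
        rw [mollify_apply]
        refine (abs_integral_le_integral_abs).trans ?_
        refine le_trans ?_ ((mollify_apply m (fun _ => C) z).symm.trans hconst).le
        refine integral_mono_of_nonneg (Eventually.of_forall fun x => abs_nonneg _) ?_ ?_
        · exact ((originBump m).integrable_normed.comp_sub_left z).mul_const C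
        · refine Eventually.of_forall fun x => ?_
          simp only
          rw [abs_mul, abs_of_nonneg ((originBump m).nonneg_normed _)]
          exact mul_le_mul_of_nonneg_left (hC x) ((originBump m).nonneg_normed _)
      have h2 : |g z| ≤ C := hC z
      rw [abs_le] at *
      constructor <;> linarith
    · rw [indicator_of_notMem hz]
      have hgz : ∀ x, R < ‖x‖ → g x = 0 := by
        intro x hx
        apply image_eq_zero_of_notMem_tsupport
        intro h
        have := hR h
        rw [mem_closedBall_zero_iff] at this
        linarith
      rw [mem_closedBall_zero_iff, not_le] at hz
      have h0 : mollify m g z = 0 := by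
        rw [mollify_apply]
        apply integral_eq_zero_of_ae
        refine Eventually.of_forall fun x => ?_
        simp only [Pi.zero_apply, mul_eq_zero]
        by_cases hx : R < ‖x‖
        · exact Or.inr (hgz x hx)
        · left
          rw [← Function.notMem_support, (originBump m).support_normed_eq,
            mem_ball_zero_iff, not_lt]
          have := norm_sub_norm_le z x
          have := hr1 m
          linarith
      rw [h0, hgz z (by linarith)]
      simp
  have hpt : ∀ z, Tendsto (fun m => |mollify m g z - g z|) atTop (𝓝 0) := by
    intro z
    have := ContDiffBump.convolution_tendsto_right_of_continuous (μ := (volume : Measure ℂ))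
      tendsto_originBump_rOut hg z
    have h2 := (this.sub_const (g z)).abs
    simpa [mollify] using h2
  have := tendsto_integral_of_dominated_convergence
    ((Metric.closedBall (0 : ℂ) (R + 1)).indicator (fun _ => 2 * C))
    (F := fun m z => |mollify m g z - g z|) (f := fun _ => (0 : ℝ)) (μ := volume)
    (fun m => ((integrable_mollify m hig).sub hig).abs.aestronglyMeasurable)
    ((integrable_indicator_iff Metric.isClosed_closedBall.measurableSet).mpr
      (integrableOn_const (by
        exact (isCompact_closedBall (0 : ℂ) (R + 1)).measure_lt_top.ne)))
    (fun m => Eventually.of_forall (hbd m)) (Eventually.of_forall hpt)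
  simpa using this

/-- Mollifications converge in `L¹`. -/
lemma tendsto_integral_abs_mollify_sub {w : ℂ → ℝ} (hw : Integrable w) :
    Tendsto (fun m => ∫ z, |mollify m w z - w z|) atTop (𝓝 0) := by
  rw [Metric.tendsto_atTop]
  intro ε hε
  obtain ⟨g, hgc, hgw, hgcont, hgi⟩ :=
    hw.exists_hasCompactSupport_integral_sub_le (ε := ε / 3) (by positivity)
  obtain ⟨N, hN⟩ := Metric.tendsto_atTop.mp
    (tendsto_integral_abs_mollify_sub_of_continuous hgcont hgc) (ε / 3) (by positivity)
  refine ⟨N, fun m hm => ?_⟩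
  have h1 := hN m hm
  rw [Real.dist_eq, sub_zero] at h1 ⊢
  rw [abs_of_nonneg (integral_nonneg fun z => abs_nonneg _)] at h1 ⊢
  have hd : Integrable (fun z => w z - g z) := hw.sub hgi
  have h2 := (integral_abs_mollify_le m hd).trans hgw
  have i1 : Integrable (fun z => |mollify m (fun x => w x - g x) z|) :=
    (integrable_mollify m hd).abs
  have i2 : Integrable (fun z => |mollify m g z - g z|) :=
    ((integrable_mollify m hgi).sub hgi).abs
  calc ∫ z, |mollify m w z - w z|
      ≤ ∫ z, (|mollify m (fun x => w x - g x) z| + |mollify m g z - g z| + |w z - g z|) := by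
        refine integral_mono ((integrable_mollify m hw).sub hw).abs ((i1.add i2).add hd.abs)
          fun z => ?_
        change |mollify m w z - w z| ≤
          |mollify m (fun x => w x - g x) z| + |mollify m g z - g z| + |w z - g z|
        rw [mollify_sub m hw.locallyIntegrable hgi.locallyIntegrable]
        have e : mollify m w z - w z = (mollify m w z - mollify m g z) +
          (mollify m g z - g z) - (w z - g z) := by ring
        rw [e]
        refine (abs_sub _ _).trans ?_
        gcongr
        exact abs_add_le _ _
    _ = (∫ z, |mollify m (fun x => w x - g x) z|) + (∫ z, |mollify m g z - g z|) +
        ∫ z, |w z - g z| := by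
        rw [← integral_add i1 i2]
        exact integral_add (i1.add i2) hd.abs
    _ < ε := by
        linarith [show ∫ z, |w z - g z| ≤ ε / 3 from hgw]

lemma fderiv_mollify_apply {ρ w : ℂ → ℝ} (hρ : ContDiff ℝ 1 ρ) (hc : HasCompactSupport ρ)
    (hw : LocallyIntegrable w) (z v : ℂ) :
    fderiv ℝ (convolution ρ w (ContinuousLinearMap.lsmul ℝ ℝ) volume) z v =
      convolution (fun x => fderiv ℝ ρ x v) w (ContinuousLinearMap.lsmul ℝ ℝ) volume z := by
  have e : ∀ g : ℂ → ℝ, convolution g w (ContinuousLinearMap.lsmul ℝ ℝ) volume =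
      convolution w g (ContinuousLinearMap.lsmul ℝ ℝ).flip volume := fun g =>
    (convolution_flip _).symm
  rw [e, e, (hc.hasFDerivAt_convolution_right _ hw hρ z).fderiv]
  exact convolution_precompR_apply _ hw (hc.fderiv ℝ) (hρ.continuous_fderiv (by norm_num)) z v

lemma fderiv_comp_const_sub_apply {g : ℂ → ℝ} (hg : Differentiable ℝ g) (z x v : ℂ) :
    fderiv ℝ (fun y => g (z - y)) x v = -fderiv ℝ g (z - x) v := by
  have h := (hg (z - x)).hasFDerivAt.comp x ((hasFDerivAt_id (𝕜 := ℝ) x).const_sub z)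
  have h' : fderiv ℝ (fun y => g (z - y)) x = _ := h.fderiv
  rw [h']; simp

lemma laplacian_mollify {m : ℕ} {w : ℂ → ℝ} (hw : LocallyIntegrable w) (z : ℂ) :
    Laplacian.laplacian (mollify m w) z =
      ∫ x, w x * Laplacian.laplacian (fun y => (originBump m).normed volume (z - y)) x := by
  set ρ := (originBump m).normed (volume : Measure ℂ) with hρdef
  have hρ : ContDiff ℝ 2 ρ := (originBump m).contDiff_normed (n := 2)
  have hc : HasCompactSupport ρ := (originBump m).hasCompactSupport_normed
  have hρ1 : ∀ v, ContDiff ℝ 1 (fun x => fderiv ℝ ρ x v) := fun v =>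
    (hρ.fderiv_right (m := 1) (by norm_num)).clm_apply contDiff_const
  have hc1 : ∀ v, HasCompactSupport (fun x => fderiv ℝ ρ x v) := fun v =>
    hc.fderiv_apply (𝕜 := ℝ) v
  have hρ2 : ∀ v, Continuous (fun x => fderiv ℝ (fun x => fderiv ℝ ρ x v) x v) := fun v =>
    ((hρ1 v).continuous_fderiv (by norm_num)).clm_apply continuous_const
  have hc2 : ∀ v, HasCompactSupport (fun x => fderiv ℝ (fun x => fderiv ℝ ρ x v) x v) := fun v =>
    (hc1 v).fderiv_apply (𝕜 := ℝ) v
  have key : ∀ v, fderiv ℝ (fun x => fderiv ℝ (mollify m w) x v) z v =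
      ∫ x, fderiv ℝ (fun x => fderiv ℝ ρ x v) (z - x) v * w x := by
    intro v
    have h1 : (fun x => fderiv ℝ (mollify m w) x v) =
        convolution (fun x => fderiv ℝ ρ x v) w (ContinuousLinearMap.lsmul ℝ ℝ) volume := by
      ext x
      exact fderiv_mollify_apply (hρ.of_le (by norm_num)) hc hw x v
    rw [h1, fderiv_mollify_apply (hρ1 v) (hc1 v) hw, convolution_eq_swap]
    rfl
  have hint : ∀ v, Integrable
      (fun x => fderiv ℝ (fun x => fderiv ℝ ρ x v) (z - x) v * w x) := by
    intro v
    have := (hc2 v).convolutionExists_left (ContinuousLinearMap.lsmul ℝ ℝ) (hρ2 v) hw z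
    simpa using this.integrable_swap
  have hlap : ∀ x, Laplacian.laplacian (fun y => ρ (z - y)) x = Laplacian.laplacian ρ (z - x) := by
    intro x
    have h1 : ∀ v, (fun x => fderiv ℝ (fun y => ρ (z - y)) x v) =
        fun x => - fderiv ℝ ρ (z - x) v := by
      intro v; ext x
      exact fderiv_comp_const_sub_apply (hρ.differentiable (by norm_num)) z x v
    have h2 : ∀ v, fderiv ℝ (fun x => fderiv ℝ (fun y => ρ (z - y)) x v) x v =
        fderiv ℝ (fun x => fderiv ℝ ρ x v) (z - x) v := by
      intro v
      rw [h1, fderiv_fun_neg, neg_apply,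
        fderiv_comp_const_sub_apply ((hρ1 v).differentiable (by norm_num)), neg_neg]
    rw [laplacian_eq_of_contDiffAt hρ.contDiffAt, laplacian_eq_of_contDiffAt, h2, h2]
    exact (hρ.comp (contDiff_const.sub contDiff_id)).contDiffAt
  rw [laplacian_eq_of_contDiffAt ((contDiff_mollify m hw).of_le (by norm_cast)).contDiffAt,
    key, key, ← integral_add (hint _) (hint _)]
  congr 1; ext x
  rw [hlap, laplacian_eq_of_contDiffAt hρ.contDiffAt]
  ring

/-! ### Kato's inequality -/

lemma isTestFunction_originBump_sub {m : ℕ} {z : ℂ} (h : ‖z‖ + (originBump m).rOut < 1) :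
    IsTestFunction (fun y => (originBump m).normed volume (z - y)) ∧
      ∀ y, ‖z‖ + (originBump m).rOut < ‖y‖ → (originBump m).normed volume (z - y) = 0 := by
  have h0 : ∀ y, ‖z‖ + (originBump m).rOut < ‖y‖ →
      (originBump m).normed volume (z - y) = 0 := by
    intro y hy
    rw [← Function.notMem_support, (originBump m).support_normed_eq, mem_ball_zero_iff, not_lt]
    have := norm_sub_norm_le y z
    rw [norm_sub_rev] at this
    linarith
  have hsub : tsupport (fun y => (originBump m).normed volume (z - y)) ⊆
      Metric.closedBall 0 (‖z‖ + (originBump m).rOut) := by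
    refine closure_minimal (fun y hy => ?_) Metric.isClosed_closedBall
    rw [mem_closedBall_zero_iff]
    by_contra hh
    exact hy (h0 y (not_le.mp hh))
  refine ⟨⟨?_, ?_, ?_⟩, h0⟩
  · exact (originBump m).contDiff_normed.comp (contDiff_const.sub contDiff_id)
  · exact HasCompactSupport.of_support_subset_isCompact (isCompact_closedBall _ _)
      ((subset_tsupport _).trans hsub)
  · exact hsub.trans (Metric.closedBall_subset_ball h)

/-- Inside the disk, and for small mollification radius, the Laplacian of the mollification is the
mollification of the weak Laplacian. The functions are cut off outside a closed ball to make them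
integrable on the plane. -/
lemma HasWeakLaplacian.laplacian_mollify {w f : ℂ → ℝ} (h : HasWeakLaplacian w f) {R : ℝ}
    (hR : R < 1) {m : ℕ} {z : ℂ} (hz : ‖z‖ + (originBump m).rOut ≤ R) :
    Laplacian.laplacian (mollify m ((Metric.closedBall 0 R).indicator w)) z =
      mollify m ((Metric.closedBall 0 R).indicator f) z := by
  obtain ⟨ht, h0⟩ := isTestFunction_originBump_sub (hz.trans_lt hR)
  have key : ∀ y, y ∉ Metric.closedBall (0 : ℂ) R → (originBump m).normed volume (z - y) = 0 := by
    intro y hy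
    rw [mem_closedBall_zero_iff, not_le] at hy
    exact h0 y (by linarith)
  have key2 : ∀ y, y ∉ Metric.closedBall (0 : ℂ) R →
      Laplacian.laplacian (fun y => (originBump m).normed volume (z - y)) y = 0 := by
    intro y hy
    apply laplacian_eq_zero_of_notMem_tsupport
    intro hh
    refine hy (closure_minimal (fun x hx => ?_) Metric.isClosed_closedBall hh)
    by_contra hx'
    exact hx (key x hx')
  rw [_root_.laplacian_mollify
    (LocallyIntegrableOn.integrable_indicator_closedBall h.left hR).locallyIntegrable,
    mollify_apply]
  calc _ = ∫ x, w x * Laplacian.laplacian (fun y => (originBump m).normed volume (z - y)) x := by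
        congr 1; ext x
        by_cases hx : x ∈ Metric.closedBall (0 : ℂ) R
        · rw [indicator_of_mem hx]
        · rw [key2 x hx]; simp
    _ = ∫ x, f x * (originBump m).normed volume (z - x) := h.weak_eq _ ht
    _ = _ := by
        congr 1; ext x
        by_cases hx : x ∈ Metric.closedBall (0 : ℂ) R
        · rw [indicator_of_mem hx, mul_comm]
        · rw [key x hx]; simp

lemma abs_sub_le_of_hasDerivAt {J J' : ℝ → ℝ} (hJ : ∀ t, HasDerivAt J (J' t) t)
    (hb : ∀ t, |J' t| ≤ 1) (a b : ℝ) : |J a - J b| ≤ |a - b| := by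
  have := Convex.norm_image_sub_le_of_norm_hasDerivWithin_le (f := J) (f' := J') (s := univ)
    (C := 1) (fun x _ => (hJ x).hasDerivWithinAt) (fun x _ => hb x) convex_univ (mem_univ b)
    (mem_univ a)
  simpa using this

lemma LocallyIntegrableOn.comp_lipschitz {w : ℂ → ℝ} {j : ℝ → ℝ} (hj : Continuous j)
    (hb : ∀ a b, |j a - j b| ≤ |a - b|) (hw : LocallyIntegrableOn w unitDisk) :
    LocallyIntegrableOn (fun z => j (w z)) unitDisk := by
  rw [locallyIntegrableOn_iff (by exact Metric.isOpen_ball.isLocallyClosed)] at hw ⊢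
  intro K hK hKc
  have h1 := hw K hK hKc
  have h2 : IntegrableOn (fun z => |w z| + |j 0|) K :=
    h1.abs.add (integrableOn_const hKc.measure_lt_top.ne)
  refine Integrable.mono' h2 (hj.comp_aestronglyMeasurable h1.aestronglyMeasurable)
    (Eventually.of_forall fun z => ?_)
  have := hb (w z) 0
  rw [sub_zero] at this
  rw [Real.norm_eq_abs]
  calc |j (w z)| = |(j (w z) - j 0) + j 0| := by ring_nf
    _ ≤ |j (w z) - j 0| + |j 0| := abs_add_le _ _
    _ ≤ _ := by gcongr

/-- **Kato's inequality**: if `Δw = f` weakly and `J` is a convex `C²` function with slopes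
in `[-1, 1]`, then `Δ J(w) ≥ J'(w) f` weakly: apply the chain rule to mollifications. -/
theorem HasWeakLaplacian.kato {w f φ : ℂ → ℝ} (h : HasWeakLaplacian w f) {J J' J'' : ℝ → ℝ}
    (hJc : ContDiff ℝ 2 J) (hJ : ∀ t, HasDerivAt J (J' t) t) (hJ' : ∀ t, HasDerivAt J' (J'' t) t)
    (hJ'' : ∀ t, 0 ≤ J'' t) (hb : ∀ t, |J' t| ≤ 1) (hφ : IsTestFunction φ) (hφ0 : ∀ z, 0 ≤ φ z) :
    ∫ z, J' (w z) * f z * φ z ≤ ∫ z, J (w z) * Laplacian.laplacian φ z := by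
  obtain ⟨ρ, hρ0, hρ1, hρ⟩ := hφ.exists_radius
  set R := (1 + ρ) / 2 with hRdef
  have hR1 : R < 1 := by rw [hRdef]; linarith
  have hρR : ρ < R := by rw [hRdef]; linarith
  set B := Metric.closedBall (0 : ℂ) R with hB
  set w₁ := B.indicator w with hw₁
  set f₁ := B.indicator f with hf₁
  have hwi : Integrable w₁ := LocallyIntegrableOn.integrable_indicator_closedBall h.left hR1
  have hfi : Integrable f₁ := LocallyIntegrableOn.integrable_indicator_closedBall h.right hR1
  have hmem : ∀ z, z ∈ tsupport φ → z ∈ B := fun z hz =>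
    Metric.closedBall_subset_closedBall hρR.le (hρ hz)
  have hJcont : Continuous J := hJc.continuous
  have hJ'cont : Continuous J' :=
    continuous_iff_continuousAt.mpr fun t => (hJ' t).continuousAt
  have hLip := abs_sub_le_of_hasDerivAt hJ hb
  -- Replace `w` and `f` by their truncations.
  have e1 : ∫ z, J' (w z) * f z * φ z = ∫ z, J' (w₁ z) * f₁ z * φ z := by
    congr 1; ext z
    by_cases hz : z ∈ tsupport φ
    · rw [hw₁, hf₁, indicator_of_mem (hmem z hz), indicator_of_mem (hmem z hz)]
    · rw [image_eq_zero_of_notMem_tsupport hz]; simp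
  have e2 : ∫ z, J (w z) * Laplacian.laplacian φ z =
      ∫ z, J (w₁ z) * Laplacian.laplacian φ z := by
    congr 1; ext z
    by_cases hz : z ∈ tsupport φ
    · rw [hw₁, indicator_of_mem (hmem z hz)]
    · rw [laplacian_eq_zero_of_notMem_tsupport hz]; simp
  rw [e1, e2]
  have hsm : ∀ m, ContDiff ℝ 2 (mollify m w₁) := fun m =>
    (contDiff_mollify m hwi.locallyIntegrable).of_le (by norm_cast)
  have hcomp : ∀ m, ContDiff ℝ 2 (fun z => J (mollify m w₁ z)) := fun m => hJc.comp (hsm m)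
  obtain ⟨C, hC⟩ := hφ.continuous.bounded_above_of_compact_support hφ.hasCompactSupport
  obtain ⟨D, hD⟩ := hφ.continuous_laplacian.bounded_above_of_compact_support
    hφ.hasCompactSupport_laplacian
  have hmc : ∀ m, Continuous (mollify m w₁) := fun m => (hsm m).continuous
  have hfc : ∀ m, Continuous (mollify m f₁) := fun m =>
    (contDiff_mollify m hfi.locallyIntegrable).continuous
  -- The inequality for the mollified functions.
  have hineq : ∀ᶠ m in atTop, ∫ z, J' (mollify m w₁ z) * mollify m f₁ z * φ z ≤
      ∫ z, J (mollify m w₁ z) * Laplacian.laplacian φ z := by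
    filter_upwards [tendsto_originBump_rOut.eventually (gt_mem_nhds (sub_pos.mpr hρR))] with m hm
    rw [integral_mul_laplacian_eq (hcomp m) hφ.contDiff_two hφ.hasCompactSupport]
    apply integral_mono
    · exact (((hJ'cont.comp (hmc m)).mul (hfc m)).mul
        hφ.continuous).integrable_of_hasCompactSupport hφ.hasCompactSupport.mul_left
    · exact ((continuous_laplacian (hcomp m)).mul
        hφ.continuous).integrable_of_hasCompactSupport hφ.hasCompactSupport.mul_left
    · intro z
      by_cases hz : z ∈ tsupport φ
      · refine mul_le_mul_of_nonneg_right ?_ (hφ0 z)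
        have hzn : ‖z‖ ≤ ρ := mem_closedBall_zero_iff.mp (hρ hz)
        rw [laplacian_comp_real (hsm m).contDiffAt (Eventually.of_forall hJ) (hJ' _),
          h.laplacian_mollify hR1 (by linarith)]
        have := mul_nonneg (hJ'' (mollify m w₁ z)) (add_nonneg
          (sq_nonneg (fderiv ℝ (mollify m w₁) z 1))
          (sq_nonneg (fderiv ℝ (mollify m w₁) z Complex.I)))
        linarith
      · simp [image_eq_zero_of_notMem_tsupport hz]
  -- Convergence of the right-hand side.
  have hJi : ∀ {u : ℂ → ℝ}, Integrable u →
      Integrable (fun z => J (u z) * Laplacian.laplacian φ z) := by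
    intro u hu
    have hl : LocallyIntegrableOn u unitDisk := hu.locallyIntegrable.locallyIntegrableOn _
    exact hφ.integrable_mul_laplacian (LocallyIntegrableOn.comp_lipschitz hJcont hLip hl)
  have hlim1 : Tendsto (fun m => ∫ z, J (mollify m w₁ z) * Laplacian.laplacian φ z) atTop
      (𝓝 (∫ z, J (w₁ z) * Laplacian.laplacian φ z)) := by
    rw [tendsto_iff_norm_sub_tendsto_zero]
    refine squeeze_zero (fun _ => norm_nonneg _) (fun m => ?_)
      (by simpa using (tendsto_integral_abs_mollify_sub hwi).mul_const D)
    rw [← integral_sub (hJi (integrable_mollify m hwi)) (hJi hwi), ← integral_mul_const]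
    refine (norm_integral_le_integral_norm _).trans ?_
    refine integral_mono_of_nonneg (Eventually.of_forall fun _ => norm_nonneg _)
      (((integrable_mollify m hwi).sub hwi).abs.mul_const D) (Eventually.of_forall fun z => ?_)
    simp only
    rw [← sub_mul, norm_mul]
    exact mul_le_mul (hLip _ _) (hD z) (norm_nonneg _) (abs_nonneg _)
  -- Convergence of the left-hand side.
  have hbd : ∀ {u : ℂ → ℝ} {g : ℂ → ℝ}, AEStronglyMeasurable u → Integrable g →
      Integrable (fun z => J' (u z) * g z * φ z) := by
    intro u g hu hg
    refine Integrable.mono' (hg.abs.mul_const C) ?_ (Eventually.of_forall fun z => ?_)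
    · exact ((hJ'cont.comp_aestronglyMeasurable hu).mul hg.aestronglyMeasurable).mul
        hφ.continuous.aestronglyMeasurable
    · rw [norm_mul, norm_mul]
      refine mul_le_mul ?_ (hC z) (norm_nonneg _) (abs_nonneg _)
      exact mul_le_of_le_one_left (norm_nonneg _) (hb _)
  have hlim2 : Tendsto (fun m => ∫ z, J' (mollify m w₁ z) * f₁ z * φ z) atTop
      (𝓝 (∫ z, J' (w₁ z) * f₁ z * φ z)) := by
    refine tendsto_integral_of_dominated_convergence (fun z => |f₁ z| * C)
      (fun m => (hbd (hmc m).aestronglyMeasurable hfi).aestronglyMeasurable)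
      (hfi.abs.mul_const C) (fun m => Eventually.of_forall fun z => ?_) ?_
    · rw [norm_mul, norm_mul]
      refine mul_le_mul ?_ (hC z) (norm_nonneg _) (abs_nonneg _)
      exact mul_le_of_le_one_left (norm_nonneg _) (hb _)
    · filter_upwards [tendsto_mollify_ae hwi.locallyIntegrable] with z hz
      exact (((hJ'cont.tendsto _).comp hz).mul_const _).mul_const _
  have hlim3 : Tendsto (fun m => ∫ z, J' (mollify m w₁ z) * (mollify m f₁ z - f₁ z) * φ z) atTop
      (𝓝 0) := by
    refine squeeze_zero_norm (fun m => ?_)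
      (by simpa using (tendsto_integral_abs_mollify_sub hfi).mul_const C)
    rw [← integral_mul_const]
    refine (norm_integral_le_integral_norm _).trans ?_
    refine integral_mono_of_nonneg (Eventually.of_forall fun _ => norm_nonneg _)
      (((integrable_mollify m hfi).sub hfi).abs.mul_const C) (Eventually.of_forall fun z => ?_)
    simp only
    rw [norm_mul, norm_mul]
    refine mul_le_mul ?_ (hC z) (norm_nonneg _) (abs_nonneg _)
    exact mul_le_of_le_one_left (norm_nonneg _) (hb _)
  have hlim4 : Tendsto (fun m => ∫ z, J' (mollify m w₁ z) * mollify m f₁ z * φ z) atTop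
      (𝓝 (∫ z, J' (w₁ z) * f₁ z * φ z)) := by
    have := hlim2.add hlim3
    rw [add_zero] at this
    refine this.congr fun m => ?_
    refine (integral_add (hbd (hmc m).aestronglyMeasurable hfi) (hbd (hmc m).aestronglyMeasurable
      ((integrable_mollify m hfi).sub hfi))).symm.trans (integral_congr_ae
      (Eventually.of_forall fun z => ?_))
    simp only [Pi.sub_apply]
    ring
  exact le_of_tendsto_of_tendsto hlim4 hlim1 hineq

/-! ### The convex functions `√(t² + ε²)` -/

lemma hasDerivAt_sqrt_sq_add {ε : ℝ} (hε : 0 < ε) (t : ℝ) :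
    HasDerivAt (fun t : ℝ => √(t ^ 2 + ε ^ 2)) (t / √(t ^ 2 + ε ^ 2)) t := by
  have hp : 0 < t ^ 2 + ε ^ 2 := by positivity
  have h := ((hasDerivAt_pow 2 t).add_const (ε ^ 2)).sqrt hp.ne'
  convert h using 1
  have := Real.sqrt_pos.mpr hp
  field_simp
  norm_num [mul_comm]

lemma hasDerivAt_div_sqrt_sq_add {ε : ℝ} (hε : 0 < ε) (t : ℝ) :
    HasDerivAt (fun t : ℝ => t / √(t ^ 2 + ε ^ 2)) (ε ^ 2 / √(t ^ 2 + ε ^ 2) ^ 3) t := by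
  have hp : 0 < t ^ 2 + ε ^ 2 := by positivity
  have h := (hasDerivAt_id t).div (hasDerivAt_sqrt_sq_add hε t) (Real.sqrt_pos.mpr hp).ne'
  have h1 := Real.sqrt_pos.mpr hp
  have h2 := Real.sq_sqrt hp.le
  refine HasDerivAt.congr_deriv h ?_
  simp only [id_eq]
  field_simp
  linear_combination h2

lemma abs_div_sqrt_sq_add_le {ε : ℝ} (t : ℝ) : |t / √(t ^ 2 + ε ^ 2)| ≤ 1 := by
  rw [abs_div, abs_of_nonneg (Real.sqrt_nonneg _)]
  apply div_le_one_of_le₀ _ (Real.sqrt_nonneg _)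
  rw [← Real.sqrt_sq_eq_abs]
  exact Real.sqrt_le_sqrt (by nlinarith [sq_nonneg ε])

lemma contDiff_sqrt_sq_add {ε : ℝ} (hε : 0 < ε) :
    ContDiff ℝ 2 (fun t : ℝ => √(t ^ 2 + ε ^ 2)) := by
  apply ContDiff.sqrt (by fun_prop)
  intro t
  positivity

lemma abs_le_sqrt_sq_add (t ε : ℝ) : |t| ≤ √(t ^ 2 + ε ^ 2) := by
  rw [← Real.sqrt_sq_eq_abs]
  exact Real.sqrt_le_sqrt (by nlinarith [sq_nonneg ε])

lemma sqrt_sq_add_le {ε : ℝ} (hε : 0 < ε) (t : ℝ) : √(t ^ 2 + ε ^ 2) ≤ |t| + ε := by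
  rw [Real.sqrt_le_left (by positivity)]
  nlinarith [sq_abs t, abs_nonneg t]

lemma HasWeakLaplacian.kato_sqrt {w f φ : ℂ → ℝ} (h : HasWeakLaplacian w f) {ε : ℝ} (hε : 0 < ε)
    (hφ : IsTestFunction φ) (hφ0 : ∀ z, 0 ≤ φ z) :
    ∫ z, w z / √(w z ^ 2 + ε ^ 2) * f z * φ z ≤
      ∫ z, √(w z ^ 2 + ε ^ 2) * Laplacian.laplacian φ z :=
  h.kato (contDiff_sqrt_sq_add hε) (hasDerivAt_sqrt_sq_add hε) (hasDerivAt_div_sqrt_sq_add hε)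
    (fun t => by positivity) abs_div_sqrt_sq_add_le hφ hφ0

lemma HasWeakLaplacian.locallyIntegrableOn_sqrt {w f : ℂ → ℝ} (h : HasWeakLaplacian w f) {ε : ℝ}
    (hε : 0 < ε) : LocallyIntegrableOn (fun z => √(w z ^ 2 + ε ^ 2)) unitDisk :=
  LocallyIntegrableOn.comp_lipschitz (j := fun t => √(t ^ 2 + ε ^ 2))
    (contDiff_sqrt_sq_add hε).continuous
    (abs_sub_le_of_hasDerivAt (hasDerivAt_sqrt_sq_add hε) abs_div_sqrt_sq_add_le) h.left

/-! ### Radial test functions and the maximum principle -/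

/-- A smooth monotone step: `0` on `(-∞, ε]` and `1` on `[2ε, ∞)`. -/
noncomputable def radialStep (ε s : ℝ) : ℝ := Real.smoothTransition ((s - ε) / ε)

/-- The antiderivative of `radialStep ε`: a convex smooth approximation of `max s 0`. -/
noncomputable def radialRamp (ε s : ℝ) : ℝ := ∫ x in (0 : ℝ)..s, radialStep ε x

section radial

variable {ε : ℝ}

lemma contDiff_radialStep : ContDiff ℝ ∞ (radialStep ε) :=
  Real.smoothTransition.contDiff.comp ((contDiff_id.sub contDiff_const).div_const _)

lemma radialStep_nonneg (s : ℝ) : 0 ≤ radialStep ε s := Real.smoothTransition.nonneg _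

lemma radialStep_le_one (s : ℝ) : radialStep ε s ≤ 1 := Real.smoothTransition.le_one _

lemma radialStep_eq_zero (hε : 0 < ε) {s : ℝ} (hs : s ≤ ε) : radialStep ε s = 0 :=
  Real.smoothTransition.zero_of_nonpos (div_nonpos_of_nonpos_of_nonneg (by linarith) hε.le)

lemma radialStep_eq_one (hε : 0 < ε) {s : ℝ} (hs : 2 * ε ≤ s) : radialStep ε s = 1 :=
  Real.smoothTransition.one_of_one_le (by rw [le_div_iff₀ hε]; linarith)

lemma monotone_radialStep (hε : 0 < ε) : Monotone (radialStep ε) := fun a b h =>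
  Real.smoothTransition.monotone (by gcongr)

lemma deriv_radialStep_nonneg (hε : 0 < ε) (s : ℝ) : 0 ≤ deriv (radialStep ε) s :=
  (monotone_radialStep hε).deriv_nonneg

lemma deriv_radialStep_eq_zero_of_lt (hε : 0 < ε) {s : ℝ} (hs : s < ε) :
    deriv (radialStep ε) s = 0 := by
  have : radialStep ε =ᶠ[𝓝 s] fun _ => 0 := by
    filter_upwards [gt_mem_nhds hs] with x hx
    exact radialStep_eq_zero hε hx.le
  rw [this.deriv_eq, deriv_const]

lemma deriv_radialStep_eq_zero_of_gt (hε : 0 < ε) {s : ℝ} (hs : 2 * ε < s) :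
    deriv (radialStep ε) s = 0 := by
  have : radialStep ε =ᶠ[𝓝 s] fun _ => 1 := by
    filter_upwards [lt_mem_nhds hs] with x hx
    exact radialStep_eq_one hε (le_of_lt hx)
  rw [this.deriv_eq, deriv_const]

lemma hasDerivAt_radialRamp (s : ℝ) : HasDerivAt (radialRamp ε) (radialStep ε s) s :=
  (contDiff_radialStep.continuous.integral_hasStrictDerivAt 0 s).hasDerivAt

lemma contDiff_radialRamp : ContDiff ℝ ∞ (radialRamp ε) := by
  rw [contDiff_infty_iff_deriv]
  refine ⟨fun s => (hasDerivAt_radialRamp s).differentiableAt, ?_⟩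
  have : deriv (radialRamp ε) = radialStep ε := funext fun s => (hasDerivAt_radialRamp s).deriv
  rw [this]
  exact contDiff_radialStep

lemma radialRamp_eq_zero (hε : 0 < ε) {s : ℝ} (hs : s ≤ ε) : radialRamp ε s = 0 := by
  rw [radialRamp]
  have : EqOn (radialStep ε) (fun _ => 0) (uIcc 0 s) := fun x hx =>
    radialStep_eq_zero hε (hx.2.trans (max_le hε.le hs))
  rw [intervalIntegral.integral_congr this]
  simp

lemma monotone_radialRamp : Monotone (radialRamp ε) :=
  monotone_of_hasDerivAt_nonneg hasDerivAt_radialRamp radialStep_nonneg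

lemma radialRamp_nonneg (hε : 0 < ε) (s : ℝ) : 0 ≤ radialRamp ε s := by
  rcases le_total s ε with h | h
  · rw [radialRamp_eq_zero hε h]
  · rw [← radialRamp_eq_zero hε le_rfl]
    exact monotone_radialRamp h

lemma sub_le_radialRamp (hε : 0 < ε) (s : ℝ) : s - 2 * ε ≤ radialRamp ε s := by
  rcases le_total s (2 * ε) with h | h
  · linarith [radialRamp_nonneg hε s]
  · have h1 : radialRamp ε s = radialRamp ε (2 * ε) + ∫ x in (2 * ε)..s, radialStep ε x := by
      rw [radialRamp, radialRamp, intervalIntegral.integral_add_adjacent_intervals]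
      all_goals exact contDiff_radialStep.continuous.intervalIntegrable _ _
    have h2 : EqOn (radialStep ε) (fun _ => 1) (uIcc (2 * ε) s) := fun x hx =>
      radialStep_eq_one hε ((le_min le_rfl h).trans hx.1)
    rw [intervalIntegral.integral_congr h2] at h1
    rw [h1]
    simp only [intervalIntegral.integral_const, smul_eq_mul, mul_one]
    linarith [radialRamp_nonneg hε (2 * ε)]

/-- The radial test function `z ↦ radialRamp ε (1 - |z|²)`. -/
noncomputable def radialTest (ε : ℝ) (z : ℂ) : ℝ := radialRamp ε (1 - ‖z‖ ^ 2)

/-- The radial cutoff `z ↦ radialStep ε (1 - |z|²)`, equal to `1` on `|z|² ≤ 1 - 2ε`. -/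
noncomputable def radialCutoff (ε : ℝ) (z : ℂ) : ℝ := radialStep ε (1 - ‖z‖ ^ 2)

/-- The nonnegative radial weight, supported in the annulus `ε ≤ 1 - |z|² ≤ 2ε`, that appears in
the Laplacian of `radialTest ε`. -/
noncomputable def radialWeight (ε : ℝ) (z : ℂ) : ℝ :=
  ‖z‖ ^ 2 * deriv (radialStep ε) (1 - ‖z‖ ^ 2)

lemma laplacian_radialTest (z : ℂ) :
    Laplacian.laplacian (radialTest ε) z = 4 * radialWeight ε z - 4 * radialCutoff ε z := by
  have hJ : ∀ t, HasDerivAt (fun t => radialRamp ε (1 - t)) (-radialStep ε (1 - t)) t :=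
    fun t => (hasDerivAt_radialRamp (1 - t)).comp_const_sub 1 t
  have hJ' : ∀ t, HasDerivAt (fun t => -radialStep ε (1 - t)) (deriv (radialStep ε) (1 - t)) t := by
    intro t
    have := ((contDiff_radialStep (ε := ε)).differentiable (by simp) (1 - t)).hasDerivAt
    exact (this.comp_const_sub 1 t).neg.congr_deriv (neg_neg _)
  have h := laplacian_comp_real (w := fun z : ℂ => ‖z‖ ^ 2) (z := z)
    (contDiff_norm_sq ℝ).contDiffAt (Eventually.of_forall hJ) (hJ' _)
  have h1 := laplacian_norm_sq (f := fun x : ℂ => x) isOpen_univ differentiableOn_id (mem_univ z)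
  have h2 := fderiv_norm_sq_sq_add (f := fun x : ℂ => x) (z := z) differentiableAt_id
  simp only [deriv_id''] at h1 h2
  change Laplacian.laplacian (fun z : ℂ => radialRamp ε (1 - ‖z‖ ^ 2)) z = _
  rw [h, h1, h2]
  simp [radialWeight, radialCutoff]
  ring

lemma radialCutoff_nonneg (z : ℂ) : 0 ≤ radialCutoff ε z := radialStep_nonneg _

lemma radialWeight_nonneg (hε : 0 < ε) (z : ℂ) : 0 ≤ radialWeight ε z :=
  mul_nonneg (sq_nonneg _) (deriv_radialStep_nonneg hε _)

lemma continuous_deriv_radialStep : Continuous (deriv (radialStep ε)) :=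
  contDiff_radialStep.continuous_deriv (by simp)

lemma continuous_radialCutoff : Continuous (radialCutoff ε) :=
  contDiff_radialStep.continuous.comp (by fun_prop)

lemma continuous_radialWeight : Continuous (radialWeight ε) :=
  (continuous_norm.pow 2).mul (continuous_deriv_radialStep.comp (by fun_prop))

lemma tsupport_subset_closedBall_sqrt {g : ℂ → ℝ} (hg : ∀ z, 1 - ‖z‖ ^ 2 < ε → g z = 0) :
    tsupport g ⊆ Metric.closedBall 0 √(1 - ε) := by
  refine closure_minimal (fun z hz => ?_) Metric.isClosed_closedBall
  rw [mem_closedBall_zero_iff]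
  by_contra hc
  have hlt := not_le.mp hc
  have := (Real.sqrt_lt' (lt_of_le_of_lt (Real.sqrt_nonneg _) hlt)).mp hlt
  exact hz (hg z (by linarith))

lemma closedBall_sqrt_subset_unitDisk (hε : 0 < ε) :
    Metric.closedBall (0 : ℂ) √(1 - ε) ⊆ unitDisk := by
  refine Metric.closedBall_subset_ball ?_
  rw [Real.sqrt_lt' one_pos]
  linarith

lemma hasCompactSupport_of_eq_zero {g : ℂ → ℝ} (hg : ∀ z, 1 - ‖z‖ ^ 2 < ε → g z = 0) :
    HasCompactSupport g :=
  HasCompactSupport.of_support_subset_isCompact (isCompact_closedBall _ _)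
    ((subset_tsupport _).trans (tsupport_subset_closedBall_sqrt hg))

lemma radialCutoff_eq_zero (hε : 0 < ε) (z : ℂ) (hz : 1 - ‖z‖ ^ 2 < ε) : radialCutoff ε z = 0 :=
  radialStep_eq_zero hε hz.le

lemma radialWeight_eq_zero (hε : 0 < ε) (z : ℂ) (hz : 1 - ‖z‖ ^ 2 < ε) :
    radialWeight ε z = 0 := by
  rw [radialWeight, deriv_radialStep_eq_zero_of_lt hε hz, mul_zero]

lemma isTestFunction_radialTest (hε : 0 < ε) : IsTestFunction (radialTest ε) := by
  have h0 : ∀ z, 1 - ‖z‖ ^ 2 < ε → radialTest ε z = 0 := fun z hz => radialRamp_eq_zero hε hz.le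
  exact ⟨contDiff_radialRamp.comp (contDiff_const.sub (contDiff_norm_sq ℝ)),
    hasCompactSupport_of_eq_zero h0,
    (tsupport_subset_closedBall_sqrt h0).trans (closedBall_sqrt_subset_unitDisk hε)⟩

lemma integrable_mul_radialCutoff (hε : 0 < ε) {q : ℂ → ℝ} (hq : LocallyIntegrableOn q unitDisk) :
    Integrable fun z => q z * radialCutoff ε z :=
  LocallyIntegrableOn.integrable_mul_of_tsupport_subset hq continuous_radialCutoff
    (hasCompactSupport_of_eq_zero (radialCutoff_eq_zero hε))
    ((tsupport_subset_closedBall_sqrt (radialCutoff_eq_zero hε)).trans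
      (closedBall_sqrt_subset_unitDisk hε))

lemma integrable_mul_radialWeight (hε : 0 < ε) {q : ℂ → ℝ} (hq : LocallyIntegrableOn q unitDisk) :
    Integrable fun z => q z * radialWeight ε z :=
  LocallyIntegrableOn.integrable_mul_of_tsupport_subset hq continuous_radialWeight
    (hasCompactSupport_of_eq_zero (radialWeight_eq_zero hε))
    ((tsupport_subset_closedBall_sqrt (radialWeight_eq_zero hε)).trans
      (closedBall_sqrt_subset_unitDisk hε))

lemma integral_mul_laplacian_radialTest (hε : 0 < ε) {q : ℂ → ℝ}
    (hq : LocallyIntegrableOn q unitDisk) :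
    ∫ z, q z * Laplacian.laplacian (radialTest ε) z =
      4 * (∫ z, q z * radialWeight ε z) - 4 * ∫ z, q z * radialCutoff ε z := by
  rw [← integral_const_mul, ← integral_const_mul,
    ← integral_sub ((integrable_mul_radialWeight hε hq).const_mul 4)
      ((integrable_mul_radialCutoff hε hq).const_mul 4)]
  congr 1; ext z
  rw [laplacian_radialTest]
  ring

lemma integrable_radialWeight (hε : 0 < ε) : Integrable (radialWeight ε) :=
  continuous_radialWeight.integrable_of_hasCompactSupport
    (hasCompactSupport_of_eq_zero (radialWeight_eq_zero hε))

/-- The integral of a Laplacian vanishes, so the weight has the same mass as the cutoff,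
which is at most the area of the disk. -/
lemma integral_radialWeight_le (hε : 0 < ε) : ∫ z, radialWeight ε z ≤ Real.pi := by
  have hφ := isTestFunction_radialTest hε
  have h1 := integral_mul_laplacian_eq (F := fun _ => 1) contDiff_const hφ.contDiff_two
    hφ.hasCompactSupport
  rw [integral_mul_laplacian_radialTest hε
    ((locallyIntegrable_const (1 : ℝ)).locallyIntegrableOn unitDisk)] at h1
  simp only [one_mul, InnerProductSpace.laplacian_const, Pi.zero_apply, zero_mul,
    integral_zero] at h1
  have iT : Integrable (radialCutoff ε) := by
    simpa using integrable_mul_radialCutoff hε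
      ((locallyIntegrable_const (1 : ℝ)).locallyIntegrableOn unitDisk)
  have e : ∫ z, radialCutoff ε z = ∫ z in unitDisk, radialCutoff ε z :=
    (setIntegral_eq_integral_of_forall_compl_eq_zero fun z hz => by
      by_contra hc
      exact hz (closedBall_sqrt_subset_unitDisk hε
        (tsupport_subset_closedBall_sqrt (radialCutoff_eq_zero hε) (subset_tsupport _ hc)))).symm
  have h2 : ∫ z in unitDisk, radialCutoff ε z ≤ Real.pi := by
    calc ∫ z in unitDisk, radialCutoff ε z ≤ ∫ z in unitDisk, (1 : ℝ) := by
          apply setIntegral_mono iT.integrableOn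
            (integrableOn_const (by simp [Complex.volume_ball]))
          exact fun z => radialStep_le_one _
      _ = Real.pi := by simp [Measure.real, Complex.volume_ball]
  linarith

end radial

lemma polarCoord_symm_eq_circleMap (p : ℝ × ℝ) :
    Complex.polarCoord.symm p = circleMap 0 p.1 p.2 := by
  rw [Complex.polarCoord_symm_apply, circleMap_zero, Complex.exp_mul_I]
  push_cast; rfl

lemma volume_restrict_polarCoord_target :
    (volume : Measure (ℝ × ℝ)).restrict polarCoord.target =
      (volume.restrict (Ioi (0 : ℝ))).prod (volume.restrict (Ioo (-Real.pi) Real.pi)) := by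
  rw [Measure.prod_restrict]; rfl

/-- Polar coordinates: a bound on circular means of `Q` bounds the integral of `Q` against a
radial weight. No measurability of `Q` is needed, since only an upper bound is claimed. -/
lemma lintegral_radial_mul_le {Q : ℂ → ENNReal} {h : ℝ → ENNReal} (hm : Measurable h)
    (hfin : ∀ r, h r ≠ ⊤) {K : ENNReal}
    (hK : ∀ᵐ r : ℝ, 0 < r → h r ≠ 0 → ∫⁻ θ in Ioo (-Real.pi) Real.pi, Q (circleMap 0 r θ) ≤
      ENNReal.ofReal (2 * Real.pi) * K) :
    ∫⁻ z, h ‖z‖ * Q z ≤ K * ∫⁻ z : ℂ, h ‖z‖ := by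
  rw [← Complex.lintegral_comp_polarCoord_symm, ← Complex.lintegral_comp_polarCoord_symm]
  have e1 : ∫⁻ p in polarCoord.target, ENNReal.ofReal p.1 •
      (h ‖Complex.polarCoord.symm p‖ * Q (Complex.polarCoord.symm p)) ≤
      ∫⁻ r in Ioi (0 : ℝ), ENNReal.ofReal r * h r * (ENNReal.ofReal (2 * Real.pi) * K) := by
    rw [volume_restrict_polarCoord_target]
    refine (lintegral_prod_le _).trans ?_
    apply lintegral_mono_ae
    rw [ae_restrict_iff' measurableSet_Ioi]
    filter_upwards [hK] with r hr hr0
    have hr0' : (0 : ℝ) < r := hr0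
    simp only [Complex.norm_polarCoord_symm, abs_of_pos hr0']
    simp only [polarCoord_symm_eq_circleMap, smul_eq_mul, ← mul_assoc]
    rw [lintegral_const_mul' _ _ (ENNReal.mul_ne_top ENNReal.ofReal_ne_top (hfin r))]
    by_cases h0 : h r = 0
    · simp [h0]
    · rw [mul_assoc (ENNReal.ofReal r * h r)]
      gcongr
      exact hr hr0' h0
  have e2 : ∫⁻ p in polarCoord.target, ENNReal.ofReal p.1 • h ‖Complex.polarCoord.symm p‖ =
      ∫⁻ r in Ioi (0 : ℝ), ENNReal.ofReal r * h r * ENNReal.ofReal (2 * Real.pi) := by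
    rw [volume_restrict_polarCoord_target]
    simp only [Complex.norm_polarCoord_symm, smul_eq_mul]
    rw [lintegral_prod _ (by fun_prop)]
    refine setLIntegral_congr_fun measurableSet_Ioi fun r hr => ?_
    simp only [abs_of_pos (show (0 : ℝ) < r from hr)]
    rw [setLIntegral_const, Real.volume_Ioo]
    ring_nf
  rw [e2, ← lintegral_const_mul _ (by fun_prop)]
  refine e1.trans (le_of_eq ?_)
  congr 1; ext r
  ring

/-- Maximum principle in integrated form: a nonnegative weakly subharmonic function on the disk
whose circular means near the boundary are at most `M` has integral at most `π M` over every
smaller disk. -/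
theorem setIntegral_ball_le_of_subharmonic {q : ℂ → ℝ} (hq : LocallyIntegrableOn q unitDisk)
    (h0 : ∀ z, 0 ≤ q z)
    (hsub : ∀ φ, IsTestFunction φ → (∀ z, 0 ≤ φ z) → 0 ≤ ∫ z, q z * Laplacian.laplacian φ z)
    {M r₀ : ℝ} (hM : 0 ≤ M) (hr₀ : r₀ < 1)
    (hbd : ∀ᵐ r : ℝ, r₀ < r → r < 1 → ∫⁻ θ in Ioo (-Real.pi) Real.pi,
      ENNReal.ofReal (q (circleMap 0 r θ)) ≤ ENNReal.ofReal (2 * Real.pi * M))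
    {ρ : ℝ} (hρ0 : 0 ≤ ρ) (hρ : ρ < 1) :
    ∫ z in Metric.ball 0 ρ, q z ≤ Real.pi * M := by
  set R := max ρ r₀ with hR
  have hR0 : 0 ≤ R := hρ0.trans (le_max_left _ _)
  have hR1 : R < 1 := max_lt hρ hr₀
  set ε := (1 - R ^ 2) / 4 with hεdef
  have hR2 : R ^ 2 < 1 := by nlinarith
  have hε : 0 < ε := by rw [hεdef]; linarith
  set T : ℂ → ℝ := radialCutoff ε with hT
  set h : ℂ → ℝ := radialWeight ε with hh
  have iqT : Integrable (fun z => q z * T z) := integrable_mul_radialCutoff hε hq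
  have iqh : Integrable (fun z => q z * h z) := integrable_mul_radialWeight hε hq
  have hT0 : ∀ z, 0 ≤ T z := radialCutoff_nonneg
  have hh0 : ∀ z, 0 ≤ h z := radialWeight_nonneg hε
  -- Testing against `radialTest ε`.
  have htest : ∫ z, q z * T z ≤ ∫ z, q z * h z := by
    have h1 := hsub _ (isTestFunction_radialTest hε) (fun z => radialRamp_nonneg hε _)
    rw [integral_mul_laplacian_radialTest hε hq] at h1
    linarith
  have hball_le : ∫ z in Metric.ball 0 ρ, q z ≤ ∫ z, q z * T z := by
    have : ∫ z in Metric.ball 0 ρ, q z = ∫ z in Metric.ball 0 ρ, q z * T z := by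
      refine setIntegral_congr_fun measurableSet_ball fun z hz => ?_
      rw [mem_ball_zero_iff] at hz
      have hzR : ‖z‖ ≤ R := hz.le.trans (le_max_left _ _)
      have : T z = 1 := radialStep_eq_one hε (by
        have : ‖z‖ ^ 2 ≤ R ^ 2 := by gcongr
        rw [hεdef]; linarith)
      simp only [this, mul_one]
    rw [this]
    exact setIntegral_le_integral iqT (Eventually.of_forall fun z => mul_nonneg (h0 z) (hT0 z))
  have hpolar : ∫ z, q z * h z ≤ M * ∫ z, h z := by
    set h' : ℝ → ℝ := fun r => r ^ 2 * deriv (radialStep ε) (1 - r ^ 2) with hh'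
    have hm : Measurable fun r => ENNReal.ofReal (h' r) := by
      apply Measurable.ennreal_ofReal
      apply Continuous.measurable
      exact (continuous_pow 2).mul (continuous_deriv_radialStep.comp (by fun_prop))
    have key := lintegral_radial_mul_le (Q := fun z => ENNReal.ofReal (q z)) hm
      (fun r => ENNReal.ofReal_ne_top) (K := ENNReal.ofReal M) (by
        filter_upwards [hbd] with r hr hr0 hne
        rw [← ENNReal.ofReal_mul (by positivity)]
        have hd : deriv (radialStep ε) (1 - r ^ 2) ≠ 0 := by
          intro hd
          apply hne
          simp [hh', hd]
        have a1 : ε ≤ 1 - r ^ 2 := by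
          by_contra hc
          exact hd (deriv_radialStep_eq_zero_of_lt hε (not_le.mp hc))
        have a2 : 1 - r ^ 2 ≤ 2 * ε := by
          by_contra hc
          exact hd (deriv_radialStep_eq_zero_of_gt hε (not_le.mp hc))
        refine hr ?_ ?_
        · refine (le_max_right ρ r₀).trans_lt ?_
          rw [← hR]
          apply lt_of_pow_lt_pow_left₀ 2 hr0.le
          rw [hεdef] at a2
          linarith
        · nlinarith)
    have e1 : ∫ z, q z * h z = (∫⁻ z, ENNReal.ofReal (h' ‖z‖) * ENNReal.ofReal (q z)).toReal := by
      rw [integral_eq_lintegral_of_nonneg_ae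
        (Eventually.of_forall fun z => mul_nonneg (h0 z) (hh0 z)) iqh.aestronglyMeasurable]
      congr 2; ext z
      rw [mul_comm, ENNReal.ofReal_mul (hh0 z)]
      rfl
    have e2 : ∫⁻ z : ℂ, ENNReal.ofReal (h' ‖z‖) = ENNReal.ofReal (∫ z, h z) :=
      (ofReal_integral_eq_lintegral_ofReal (integrable_radialWeight hε)
        (Eventually.of_forall hh0)).symm
    rw [e1]
    rw [e2, ← ENNReal.ofReal_mul hM] at key
    exact ENNReal.toReal_le_of_le_ofReal
      (mul_nonneg hM (integral_nonneg hh0)) key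
  have hweight : ∫ z, h z ≤ Real.pi := integral_radialWeight_le hε
  calc ∫ z in Metric.ball 0 ρ, q z ≤ M * ∫ z, h z := hball_le.trans (htest.trans hpolar)
    _ ≤ M * Real.pi := by gcongr
    _ = Real.pi * M := mul_comm _ _

/-! ### Rotational averages -/

/-- The average of the rotations of `v` with weight `k`, over angles in `[-π, π]`. -/
noncomputable def rotAvg (k : ℝ → ℝ) (v : ℂ → ℝ) (z : ℂ) : ℝ :=
  ∫ α in Icc (-Real.pi) Real.pi, k α * v (Circle.exp α * z)

lemma norm_circleExp_mul (α : ℝ) (z : ℂ) : ‖(Circle.exp α : ℂ) * z‖ = ‖z‖ := by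
  rw [norm_mul, Circle.norm_coe, one_mul]

lemma measurePreserving_circleExp_mul (α : ℝ) :
    MeasurePreserving (fun z : ℂ => (Circle.exp α : ℂ) * z) :=
  (rotation (Circle.exp α)).measurePreserving

lemma integral_circleExp_mul (α : ℝ) (g : ℂ → ℝ) :
    ∫ z, g (Circle.exp α * z) = ∫ z, g z :=
  (measurePreserving_circleExp_mul α).integral_comp
    (rotation (Circle.exp α)).toHomeomorph.measurableEmbedding g

lemma continuous_circleExp_mul : Continuous fun p : ℝ × ℂ => (Circle.exp p.1 : ℂ) * p.2 := by
  simp only [Circle.coe_exp]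
  fun_prop

lemma measurePreserving_skew_rotation :
    MeasurePreserving (fun p : ℝ × ℂ => (p.1, (Circle.exp p.1 : ℂ) * p.2))
      (((volume : Measure ℝ).restrict (Icc (-Real.pi) Real.pi)).prod volume)
      (((volume : Measure ℝ).restrict (Icc (-Real.pi) Real.pi)).prod volume) := by
  apply MeasurePreserving.skew_product (f := fun α : ℝ => α)
    (g := fun (α : ℝ) (z : ℂ) => (Circle.exp α : ℂ) * z) (MeasurePreserving.id _)
  · exact continuous_circleExp_mul.measurable
  · exact Eventually.of_forall fun α => (measurePreserving_circleExp_mul α).map_eq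

section rotAvg

variable {k : ℝ → ℝ} {v ψ : ℂ → ℝ}

lemma integrable_rotAvg_integrand (hk : Continuous k) (hv : LocallyIntegrableOn v unitDisk)
    (hψ : Measurable ψ) {C : ℝ} (hC : ∀ z, ‖ψ z‖ ≤ C) {ρ : ℝ} (hρ : ρ < 1)
    (hψ0 : ∀ z, z ∉ Metric.closedBall (0 : ℂ) ρ → ψ z = 0) :
    Integrable (fun p : ℝ × ℂ => k p.1 * v (Circle.exp p.1 * p.2) * ψ p.2)
      (((volume : Measure ℝ).restrict (Icc (-Real.pi) Real.pi)).prod volume) := by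
  have h1 : Integrable (fun p : ℝ × ℂ => (Metric.closedBall 0 ρ).indicator v p.2)
      (((volume : Measure ℝ).restrict (Icc (-Real.pi) Real.pi)).prod volume) :=
    (LocallyIntegrableOn.integrable_indicator_closedBall hv hρ).comp_snd _
  have h2 := measurePreserving_skew_rotation.integrable_comp_of_integrable h1
  obtain ⟨K, hK⟩ := (isCompact_Icc (a := -Real.pi) (b := Real.pi)).exists_bound_of_continuousOn
    hk.continuousOn
  have hKae : ∀ᵐ p : ℝ × ℂ ∂((volume : Measure ℝ).restrict (Icc (-Real.pi) Real.pi)).prod volume,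
      ‖k p.1 * ψ p.2‖ ≤ K * C := by
    have : ∀ᵐ α ∂(volume : Measure ℝ).restrict (Icc (-Real.pi) Real.pi), ‖k α‖ ≤ K :=
      (ae_restrict_iff' measurableSet_Icc).mpr (Eventually.of_forall hK)
    filter_upwards [Measure.quasiMeasurePreserving_fst.ae this] with p hp
    rw [norm_mul]
    exact mul_le_mul hp (hC _) (norm_nonneg _) ((norm_nonneg _).trans hp)
  have h3 := h2.bdd_mul (c := K * C) (f := fun p : ℝ × ℂ => k p.1 * ψ p.2) (by
    apply Measurable.aestronglyMeasurable
    exact (hk.measurable.comp measurable_fst).mul (hψ.comp measurable_snd)) hKae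
  refine h3.congr (Eventually.of_forall fun p => ?_)
  simp only [Function.comp_apply]
  by_cases hp : p.2 ∈ Metric.closedBall (0 : ℂ) ρ
  · have : (Circle.exp p.1 : ℂ) * p.2 ∈ Metric.closedBall (0 : ℂ) ρ := by
      rw [mem_closedBall_zero_iff] at hp ⊢
      rwa [norm_circleExp_mul]
    rw [indicator_of_mem this]
    ring
  · rw [hψ0 _ hp]; simp

lemma integral_rotAvg_mul (hk : Continuous k) (hv : LocallyIntegrableOn v unitDisk)
    (hψ : Continuous ψ) {ρ : ℝ} (hρ : ρ < 1)
    (hψ0 : ∀ z, z ∉ Metric.closedBall (0 : ℂ) ρ → ψ z = 0) :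
    ∫ z, rotAvg k v z * ψ z =
      ∫ α in Icc (-Real.pi) Real.pi, k α * ∫ z, v (Circle.exp α * z) * ψ z := by
  have hcs : HasCompactSupport ψ := HasCompactSupport.intro (isCompact_closedBall _ _) hψ0
  obtain ⟨C, hC⟩ := hψ.bounded_above_of_compact_support hcs
  have hint := integrable_rotAvg_integrand hk hv hψ.measurable hC hρ hψ0
  have := integral_integral_swap (f := fun (α : ℝ) (z : ℂ) =>
    k α * v (Circle.exp α * z) * ψ z) hint
  calc ∫ z, rotAvg k v z * ψ z
      = ∫ z, ∫ α in Icc (-Real.pi) Real.pi, k α * v (Circle.exp α * z) * ψ z := by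
        congr 1; ext z
        rw [rotAvg, ← integral_mul_const]
    _ = ∫ α in Icc (-Real.pi) Real.pi, ∫ z, k α * v (Circle.exp α * z) * ψ z := this.symm
    _ = _ := by
        congr 1; ext α
        rw [← integral_const_mul]
        congr 1; ext z; ring

lemma locallyIntegrableOn_rotAvg (hk : Continuous k) (hv : LocallyIntegrableOn v unitDisk) :
    LocallyIntegrableOn (rotAvg k v) unitDisk := by
  rw [locallyIntegrableOn_iff (by exact Metric.isOpen_ball.isLocallyClosed)]
  intro K hK hKc
  obtain ⟨ρ, ⟨-, hρ1⟩, hρ⟩ := exists_pos_lt_subset_ball one_pos hKc.isClosed hK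
  have hint := integrable_rotAvg_integrand (ψ := (Metric.closedBall 0 ρ).indicator fun _ => 1)
    hk hv (measurable_const.indicator Metric.isClosed_closedBall.measurableSet) (C := 1)
    (fun z => by
      by_cases hz : z ∈ Metric.closedBall (0 : ℂ) ρ
      · simp [hz]
      · rw [indicator_of_notMem hz]; simp) hρ1
    (fun z hz => indicator_of_notMem hz _)
  have h2 := hint.integral_prod_right
  have h3 : IntegrableOn (rotAvg k v) (Metric.closedBall 0 ρ) := by
    rw [← integrable_indicator_iff Metric.isClosed_closedBall.measurableSet]
    refine h2.congr (Eventually.of_forall fun z => ?_)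
    by_cases hz : z ∈ Metric.closedBall (0 : ℂ) ρ
    · simp only [indicator_of_mem hz, mul_one]; rfl
    · simp only [indicator_of_notMem hz, mul_zero, integral_zero]
  exact h3.mono_set (hρ.trans Metric.ball_subset_closedBall)

lemma rotAvg_nonneg (hk : ∀ α, 0 ≤ k α) (hv : ∀ z, 0 ≤ v z) (z : ℂ) : 0 ≤ rotAvg k v z :=
  integral_nonneg fun α => mul_nonneg (hk α) (hv _)

lemma IsTestFunction.comp_rotation {φ : ℂ → ℝ} (h : IsTestFunction φ) (α : ℝ) :
    IsTestFunction fun z => φ (Circle.exp α * z) := by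
  obtain ⟨ρ, h0, h1, h2⟩ := h.exists_radius
  have hsub : tsupport (fun z => φ (Circle.exp α * z)) ⊆ Metric.closedBall 0 ρ := by
    refine closure_minimal (fun z hz => ?_) Metric.isClosed_closedBall
    have := h2 (subset_tsupport φ (show φ (Circle.exp α * z) ≠ 0 from hz))
    rw [mem_closedBall_zero_iff] at this ⊢
    rwa [norm_circleExp_mul] at this
  refine ⟨h.contDiff.comp (contDiff_const.mul contDiff_id), ?_, ?_⟩
  · exact HasCompactSupport.of_support_subset_isCompact (isCompact_closedBall _ _)
      ((subset_tsupport _).trans hsub)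
  · exact hsub.trans (Metric.closedBall_subset_ball h1)

/-- Rotational averaging commutes with the weak Laplacian. -/
lemma HasWeakLaplacian.rotationalAverage {w f : ℂ → ℝ} (h : HasWeakLaplacian w f)
    (hk : Continuous k) :
    HasWeakLaplacian (rotAvg k w) (rotAvg k f) := by
  refine ⟨locallyIntegrableOn_rotAvg hk h.left, locallyIntegrableOn_rotAvg hk h.right,
    fun φ hφ => ?_⟩
  obtain ⟨ρ, h0, h1, h2⟩ := hφ.exists_radius
  rw [integral_rotAvg_mul hk h.left hφ.continuous_laplacian h1
      (fun z hz => laplacian_eq_zero_of_notMem_tsupport fun hh => hz (h2 hh)),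
    integral_rotAvg_mul hk h.right hφ.continuous h1
      (fun z hz => image_eq_zero_of_notMem_tsupport fun hh => hz (h2 hh))]
  congr 1; ext α
  congr 1
  have hrot : ∀ z : ℂ, (Circle.exp (-α) : ℂ) * (Circle.exp α * z) = z := by
    intro z
    rw [← mul_assoc, ← Circle.coe_mul, ← Circle.exp_add]
    simp
  have e : ∀ g ψ : ℂ → ℝ, ∫ z, g (Circle.exp α * z) * ψ z =
      ∫ z, g z * ψ (Circle.exp (-α) * z) := by
    intro g ψ
    refine Eq.trans ?_ (integral_circleExp_mul α fun z => g z * ψ (Circle.exp (-α) * z))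
    congr 1; ext z
    exact congrArg (fun x => g (Circle.exp α * z) * ψ x) (hrot z).symm
  rw [e, e, ← h.weak_eq _ (hφ.comp_rotation (-α))]
  congr 1; ext z
  rw [laplacian_comp_mul_of_norm_eq_one hφ.contDiff_two (Circle.norm_coe _)]

end rotAvg

/-! ### Boundary behaviour of rotational averages -/

/-- The kernels `((1 + cos α) / 2) ^ N`, which concentrate at `α = 0` as `N → ∞`. -/
noncomputable def cosKernel (N : ℕ) (α : ℝ) : ℝ := ((1 + Real.cos α) / 2) ^ N

lemma continuous_cosKernel (N : ℕ) : Continuous (cosKernel N) := by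
  unfold cosKernel; fun_prop

lemma cosKernel_nonneg (N : ℕ) (α : ℝ) : 0 ≤ cosKernel N α :=
  pow_nonneg (by linarith [Real.neg_one_le_cos α]) _

lemma circleExp_mul_circleMap (α r θ : ℝ) :
    (Circle.exp α : ℂ) * circleMap 0 r θ = circleMap 0 r (α + θ) := by
  rw [circleMap_zero, circleMap_zero, Circle.coe_exp]
  push_cast
  rw [add_mul, Complex.exp_add]
  ring

/-- On circles, the rotational average is the convolution of the kernel with the restriction
of the function. -/
lemma rotAvg_cosKernel_circleMap (N : ℕ) (w : ℂ → ℝ) (r θ : ℝ) :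
    rotAvg (cosKernel N) w (circleMap 0 r θ) =
      ∫ β in (0 : ℝ)..2 * Real.pi, cosKernel N (β - θ) * w (circleMap 0 r β) := by
  have hper : Function.Periodic (fun β => cosKernel N (β - θ) * w (circleMap 0 r β))
      (2 * Real.pi) := by
    intro β
    simp only [cosKernel, periodic_circleMap 0 r β]
    rw [show β + 2 * Real.pi - θ = (β - θ) + 2 * Real.pi by ring, Real.cos_add_two_pi]
  have h1 := hper.intervalIntegral_add_eq 0 (-Real.pi + θ)
  rw [zero_add] at h1
  rw [h1, rotAvg, integral_Icc_eq_integral_Ioc,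
    ← intervalIntegral.integral_of_le (by linarith [Real.pi_pos])]
  have h2 := intervalIntegral.integral_comp_add_right (a := -Real.pi) (b := Real.pi)
    (fun β => cosKernel N (β - θ) * w (circleMap 0 r β)) θ
  rw [show -Real.pi + θ + 2 * Real.pi = Real.pi + θ by ring, ← h2]
  congr 1; ext α
  rw [circleExp_mul_circleMap, add_sub_cancel_right]

/-- If the measures `w(re^{iθ}) dθ` converge weak-* to `0`, then convolution with a power of
`1 + cos` makes the convergence uniform, because these kernels have finite rank. -/
lemma eventually_abs_integral_cosKernel_le {w : ℂ → ℝ} (hw : HasBoundaryValues w fun _ => 0)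
    (N : ℕ) : ∀ φ : ℂ → ℝ, ContinuousOn φ (Metric.sphere (0 : ℂ) 1) → ∀ ε > 0,
      ∀ᶠ r : ℝ in 𝓝[<] 1, ∀ θ : ℝ,
        |∫ β in (0 : ℝ)..2 * Real.pi,
          cosKernel N (β - θ) * (φ (circleMap 0 1 β) * w (circleMap 0 r β))| ≤ ε := by
  induction N with
  | zero =>
    intro φ hφ ε hε
    have h := hw.tendsto φ hφ
    simp only [mul_zero, intervalIntegral.integral_zero] at h
    filter_upwards [(tendsto_order.mp h.abs).2 ε (by simpa using hε)] with r hr θ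
    simpa [cosKernel] using hr.le
  | succ N ih =>
    intro φ hφ ε hε
    have hre : ContinuousOn (fun z => φ z * z.re) (Metric.sphere (0 : ℂ) 1) :=
      hφ.mul Complex.continuous_re.continuousOn
    have him : ContinuousOn (fun z => φ z * z.im) (Metric.sphere (0 : ℂ) 1) :=
      hφ.mul Complex.continuous_im.continuousOn
    filter_upwards [ih φ hφ (ε / 2) (by positivity), ih _ hre (ε / 2) (by positivity),
      ih _ him (ε / 2) (by positivity), hw.circleIntegrable] with r h1 h2 h3 hr θ
    have hc : ∀ g : ℂ → ℝ, ContinuousOn g (Metric.sphere (0 : ℂ) 1) →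
        IntervalIntegrable (fun β => cosKernel N (β - θ) *
          (g (circleMap 0 1 β) * w (circleMap 0 r β))) volume 0 (2 * Real.pi) := by
      intro g hg
      have hgc : Continuous fun β => g (circleMap 0 1 β) :=
        hg.comp_continuous (continuous_circleMap 0 1) fun β => circleMap_mem_sphere 0 zero_le_one β
      have hkc : Continuous fun β => cosKernel N (β - θ) :=
        (continuous_cosKernel N).comp (by fun_prop)
      have hr' : IntervalIntegrable (fun β => w (circleMap 0 r β)) volume 0 (2 * Real.pi) := hr
      exact (hr'.continuousOn_mul hgc.continuousOn).continuousOn_mul hkc.continuousOn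
    have e : ∀ β, cosKernel (N + 1) (β - θ) * (φ (circleMap 0 1 β) * w (circleMap 0 r β)) =
        1 / 2 * (cosKernel N (β - θ) * (φ (circleMap 0 1 β) * w (circleMap 0 r β))) +
        Real.cos θ / 2 * (cosKernel N (β - θ) *
          (φ (circleMap 0 1 β) * (circleMap 0 1 β).re * w (circleMap 0 r β))) +
        Real.sin θ / 2 * (cosKernel N (β - θ) *
          (φ (circleMap 0 1 β) * (circleMap 0 1 β).im * w (circleMap 0 r β))) := by
      intro β
      have e1 : (circleMap 0 1 β).re = Real.cos β := by
        simp [circleMap_zero, Complex.exp_ofReal_mul_I_re]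
      have e2 : (circleMap 0 1 β).im = Real.sin β := by
        simp [circleMap_zero, Complex.exp_ofReal_mul_I_im]
      rw [e1, e2]
      simp only [cosKernel, pow_succ]
      rw [Real.cos_sub]
      ring
    simp only [e]
    rw [intervalIntegral.integral_add (((hc φ hφ).const_mul _).add ((hc _ hre).const_mul _))
        ((hc _ him).const_mul _),
      intervalIntegral.integral_add ((hc φ hφ).const_mul _) ((hc _ hre).const_mul _),
      intervalIntegral.integral_const_mul, intervalIntegral.integral_const_mul,
      intervalIntegral.integral_const_mul]
    have b2 : ∀ a c : ℝ, |a| ≤ 1 → |c| ≤ ε / 2 → |a / 2 * c| ≤ ε / 4 := by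
      intro a c ha hc'
      rw [abs_mul, abs_div, abs_two]
      nlinarith [abs_nonneg a, abs_nonneg c]
    have t1 := b2 1 _ (by simp) (h1 θ)
    have t2 := b2 (Real.cos θ) _ (Real.abs_cos_le_one θ) (h2 θ)
    have t3 := b2 (Real.sin θ) _ (Real.abs_sin_le_one θ) (h3 θ)
    refine (abs_add_three _ _ _).trans ?_
    linarith

lemma eventually_abs_rotAvg_cosKernel_le {w : ℂ → ℝ} (hw : HasBoundaryValues w fun _ => 0)
    (N : ℕ) {ε : ℝ} (hε : 0 < ε) :
    ∀ᶠ r : ℝ in 𝓝[<] 1, ∀ θ : ℝ, |rotAvg (cosKernel N) w (circleMap 0 r θ)| ≤ ε := by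
  filter_upwards [eventually_abs_integral_cosKernel_le hw N (fun _ => 1) continuousOn_const ε hε]
    with r hr θ
  rw [rotAvg_cosKernel_circleMap]
  simpa using hr θ

/-! ### Comparison with the boundary values -/

lemma ae_unitDisk_of_forall_ball {P : ℂ → Prop}
    (h : ∀ ρ : ℝ, 0 < ρ → ρ < 1 → ∀ᵐ z ∂volume.restrict (Metric.ball (0 : ℂ) ρ), P z) :
    ∀ᵐ z ∂volume.restrict unitDisk, P z := by
  have hU : unitDisk ⊆ ⋃ n : ℕ, Metric.ball (0 : ℂ) (1 - 1 / ((n : ℝ) + 2)) := by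
    intro z hz
    rw [mem_ball_zero_iff] at hz
    obtain ⟨n, hn⟩ := exists_nat_one_div_lt (sub_pos.mpr hz)
    refine mem_iUnion.mpr ⟨n, ?_⟩
    rw [mem_ball_zero_iff]
    have : 1 / ((n : ℝ) + 2) ≤ 1 / ((n : ℝ) + 1) := by gcongr; norm_num
    linarith
  refine ae_restrict_of_ae_restrict_of_subset hU ?_
  rw [ae_restrict_iUnion_iff]
  intro n
  apply h
  · rw [sub_pos, div_lt_one (by positivity)]
    have : (0 : ℝ) ≤ n := by positivity
    linarith
  · have : (0 : ℝ) < 1 / ((n : ℝ) + 2) := by positivity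
    linarith

lemma ae_eq_zero_of_setIntegral_ball_le {q : ℂ → ℝ} (hq : LocallyIntegrableOn q unitDisk)
    (h0 : ∀ z, 0 ≤ q z)
    (h : ∀ ρ : ℝ, 0 < ρ → ρ < 1 → ∀ ε > 0, ∫ z in Metric.ball 0 ρ, q z ≤ ε) :
    ∀ᵐ z ∂volume.restrict unitDisk, q z = 0 := by
  refine ae_unitDisk_of_forall_ball fun ρ hρ0 hρ1 => ?_
  have h1 : ∫ z in Metric.ball 0 ρ, q z = 0 :=
    le_antisymm (le_of_forall_pos_le_add fun ε hε => by simpa using h ρ hρ0 hρ1 ε hε)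
      (integral_nonneg h0)
  have hi : IntegrableOn q (Metric.ball 0 ρ) :=
    (hq.integrableOn_compact_subset (Metric.closedBall_subset_ball hρ1)
      (isCompact_closedBall _ _)).mono_set Metric.ball_subset_closedBall
  exact (integral_eq_zero_iff_of_nonneg h0 hi).mp h1

lemma exists_Ioo_of_eventually {P : ℝ → Prop} (h : ∀ᶠ r in 𝓝[<] (1 : ℝ), P r) :
    ∃ r₀, 0 < r₀ ∧ r₀ < 1 ∧ ∀ r, r₀ < r → r < 1 → P r := by
  obtain ⟨a, ha, hs⟩ := (mem_nhdsLT_iff_exists_Ioo_subset).mp h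
  refine ⟨max a (1 / 2), by positivity, max_lt ha (by norm_num), fun r h1 h2 => ?_⟩
  exact hs ⟨(le_max_left _ _).trans_lt h1, h2⟩

lemma lintegral_Ioo_const_le {g : ℝ → ENNReal} {M : ℝ} (h : ∀ θ, g θ ≤ ENNReal.ofReal M) :
    ∫⁻ θ in Ioo (-Real.pi) Real.pi, g θ ≤ ENNReal.ofReal (2 * Real.pi * M) := by
  calc ∫⁻ θ in Ioo (-Real.pi) Real.pi, g θ
      ≤ ∫⁻ _ in Ioo (-Real.pi) Real.pi, ENNReal.ofReal M := lintegral_mono h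
    _ = ENNReal.ofReal (2 * Real.pi * M) := by
        rw [setLIntegral_const, Real.volume_Ioo, mul_comm, ← ENNReal.ofReal_mul
          (by linarith [Real.pi_pos])]
        ring_nf

/-- A weakly subharmonic function that tends to `0` uniformly at the unit circle is nonpositive. -/
lemma HasWeakLaplacian.ae_nonpos {w f : ℂ → ℝ} (h : HasWeakLaplacian w f) (hf : ∀ z, 0 ≤ f z)
    (hb : ∀ ε > 0, ∀ᶠ r : ℝ in 𝓝[<] 1, ∀ θ : ℝ, |w (circleMap 0 r θ)| ≤ ε) :
    ∀ᵐ z ∂volume.restrict unitDisk, w z ≤ 0 := by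
  have hq0 : LocallyIntegrableOn (fun z => w z + |w z|) unitDisk := by
    refine h.left.add ?_
    exact LocallyIntegrableOn.comp_lipschitz (j := fun t => |t|) continuous_abs
      (fun a b => abs_abs_sub_abs_le _ _) h.left
  have hmain := ae_eq_zero_of_setIntegral_ball_le hq0
    (fun z => by linarith [neg_abs_le (w z)]) ?_
  · filter_upwards [hmain] with z hz
    linarith [abs_nonneg (w z)]
  intro ρ hρ0 hρ1 ε' hε'
  -- Use the convex increasing function `t + √(t² + ε²)` in Kato's inequality.
  set ε := ε' / (3 * Real.pi) with hεdef
  have hε : 0 < ε := by have := Real.pi_pos; positivity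
  set q : ℂ → ℝ := fun z => w z + √(w z ^ 2 + ε ^ 2) with hqdef
  have hqi : LocallyIntegrableOn q unitDisk := h.left.add (h.locallyIntegrableOn_sqrt hε)
  have hle : ∀ z, w z + |w z| ≤ q z := fun z => by
    simp only [hqdef]; gcongr; exact abs_le_sqrt_sq_add _ _
  have hqn : ∀ z, 0 ≤ q z := fun z => le_trans (by linarith [neg_abs_le (w z)]) (hle z)
  have hsub : ∀ φ, IsTestFunction φ → (∀ z, 0 ≤ φ z) →
      0 ≤ ∫ z, q z * Laplacian.laplacian φ z := by
    intro φ hφ hφ0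
    have h1 := h.kato_sqrt hε hφ hφ0
    have h2 := h.weak_eq φ hφ
    have h3 : ∫ z, q z * Laplacian.laplacian φ z = (∫ z, w z * Laplacian.laplacian φ z) +
        ∫ z, √(w z ^ 2 + ε ^ 2) * Laplacian.laplacian φ z := by
      rw [← integral_add (hφ.integrable_mul_laplacian h.left)
        (hφ.integrable_mul_laplacian (h.locallyIntegrableOn_sqrt hε))]
      congr 1; ext z; simp only [hqdef]; ring
    have hi1 : Integrable (fun z => f z * φ z) := hφ.integrable_mul h.right
    -- A non-integrable function has integral `0` by convention, which is enough here.
    have h4 : 0 ≤ (∫ z, w z / √(w z ^ 2 + ε ^ 2) * f z * φ z) + ∫ z, f z * φ z := by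
      by_cases hi : Integrable (fun z => w z / √(w z ^ 2 + ε ^ 2) * f z * φ z)
      · rw [← integral_add hi hi1]
        refine integral_nonneg fun z => ?_
        have e : w z / √(w z ^ 2 + ε ^ 2) * f z * φ z + f z * φ z =
          (w z / √(w z ^ 2 + ε ^ 2) + 1) * (f z * φ z) := by ring
        simp only [Pi.zero_apply, e]
        refine mul_nonneg ?_ (mul_nonneg (hf z) (hφ0 z))
        linarith [(abs_le.mp (abs_div_sqrt_sq_add_le (ε := ε) (w z))).1]
      · rw [integral_undef hi, zero_add]
        exact integral_nonneg fun z => mul_nonneg (hf z) (hφ0 z)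
    linarith
  obtain ⟨r₀, -, hr₀, hr⟩ := exists_Ioo_of_eventually (hb ε hε)
  have hfin := setIntegral_ball_le_of_subharmonic hqi hqn hsub (M := 3 * ε) (by positivity) hr₀
    (Eventually.of_forall fun r h1 h2 => lintegral_Ioo_const_le fun θ => by
      apply ENNReal.ofReal_le_ofReal
      have a1 := hr r h1 h2 θ
      have a2 := sqrt_sq_add_le hε (w (circleMap 0 r θ))
      have a3 := le_abs_self (w (circleMap 0 r θ))
      simp only [hqdef]
      linarith) hρ0.le hρ1
  have hi : ∀ {u : ℂ → ℝ}, LocallyIntegrableOn u unitDisk → IntegrableOn u (Metric.ball 0 ρ) :=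
    fun hu => (hu.integrableOn_compact_subset (Metric.closedBall_subset_ball hρ1)
      (isCompact_closedBall _ _)).mono_set Metric.ball_subset_closedBall
  calc ∫ z in Metric.ball 0 ρ, (w z + |w z|) ≤ ∫ z in Metric.ball 0 ρ, q z :=
        setIntegral_mono (hi hq0) (hi hqi) hle
    _ ≤ Real.pi * (3 * ε) := hfin
    _ = ε' := by
        rw [hεdef]
        have := Real.pi_pos.ne'
        field_simp

lemma continuous_integral_mul_comp_rotation {w ψ : ℂ → ℝ} (hw : LocallyIntegrableOn w unitDisk)
    (hψ : Continuous ψ) {ρ : ℝ} (hρ : ρ < 1)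
    (hψ0 : ∀ z, z ∉ Metric.closedBall (0 : ℂ) ρ → ψ z = 0) :
    Continuous fun α : ℝ => ∫ z, w (Circle.exp α * z) * ψ z := by
  have hcs : HasCompactSupport ψ := HasCompactSupport.intro (isCompact_closedBall _ _) hψ0
  obtain ⟨C, hC⟩ := hψ.bounded_above_of_compact_support hcs
  set w₁ := (Metric.closedBall (0 : ℂ) ρ).indicator w with hw₁
  have hi : Integrable w₁ := LocallyIntegrableOn.integrable_indicator_closedBall hw hρ
  have e : (fun α : ℝ => ∫ z, w (Circle.exp α * z) * ψ z) =
      fun α : ℝ => ∫ z, w₁ z * ψ (Circle.exp (-α) * z) := by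
    ext α
    refine Eq.trans ?_ (integral_circleExp_mul α fun z => w₁ z * ψ (Circle.exp (-α) * z))
    congr 1; ext z
    have hrot : (Circle.exp (-α) : ℂ) * (Circle.exp α * z) = z := by
      rw [← mul_assoc, ← Circle.coe_mul, ← Circle.exp_add]
      simp
    refine Eq.trans ?_
      (congrArg (fun x => w₁ (Circle.exp α * z) * ψ x) hrot.symm)
    by_cases hz : z ∈ Metric.closedBall (0 : ℂ) ρ
    · have : (Circle.exp α : ℂ) * z ∈ Metric.closedBall (0 : ℂ) ρ := by
        rw [mem_closedBall_zero_iff] at hz ⊢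
        rwa [norm_circleExp_mul]
      simp only [hw₁]
      rw [indicator_of_mem this]
    · simp [hψ0 z hz]
  rw [e]
  refine continuous_of_dominated (bound := fun z => |w₁ z| * C) ?_ ?_ (hi.abs.mul_const C) ?_
  · intro α
    refine hi.aestronglyMeasurable.mul (Continuous.aestronglyMeasurable ?_)
    exact hψ.comp (continuous_const.mul continuous_id)
  · intro α
    refine Eventually.of_forall fun z => ?_
    rw [norm_mul]
    exact mul_le_mul_of_nonneg_left (hC _) (norm_nonneg _)
  · refine Eventually.of_forall fun z => continuous_const.mul (hψ.comp ?_)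
    simp only [Circle.coe_exp]
    fun_prop

/-- The kernels `cosKernel N`, normalised, form an approximate identity at `0`. -/
lemma nonpos_of_forall_integral_cosKernel_nonpos {m : ℝ → ℝ} (hm : Continuous m)
    (h : ∀ N, ∫ α in Icc (-Real.pi) Real.pi, cosKernel N α * m α ≤ 0) : m 0 ≤ 0 := by
  have hpi := Real.pi_pos
  have := tendsto_setIntegral_pow_smul_of_unique_maximum_of_isCompact_of_continuousOn
    (μ := (volume : Measure ℝ)) (s := Icc (-Real.pi) Real.pi) (x₀ := 0) (g := m)
    (c := fun α => (1 + Real.cos α) / 2) isCompact_Icc (by fun_prop)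
    (fun y hy hy0 => by
      have : Real.cos y < 1 := by
        refine lt_of_le_of_ne (Real.cos_le_one y) fun hc => hy0 ?_
        exact (Real.cos_eq_one_iff_of_lt_of_lt (by linarith [hy.1]) (by linarith [hy.2])).mp hc
      simp only [Real.cos_zero]
      linarith)
    (fun x _ => by linarith [Real.neg_one_le_cos x]) (by simp)
    (by
      rw [interior_Icc, closure_Ioo (by linarith)]
      exact ⟨by linarith, by linarith⟩) hm.continuousOn
  refine le_of_tendsto this (Eventually.of_forall fun N => ?_)
  simp only [smul_eq_mul]
  refine mul_nonpos_of_nonneg_of_nonpos (inv_nonneg.mpr ?_) (h N)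
  exact setIntegral_nonneg measurableSet_Icc fun x _ => cosKernel_nonneg N x

/-- A weakly subharmonic function with boundary values `0`, in the sense of weak-* convergence
of measures, is nonpositive: its averages against `cosKernel N` are, by uniform convergence at the
circle, and the averages recover the function as `N → ∞`. -/
lemma HasWeakLaplacian.ae_nonpos_of_hasBoundaryValues {w f : ℂ → ℝ} (h : HasWeakLaplacian w f)
    (hf : ∀ z, 0 ≤ f z) (hb : HasBoundaryValues w fun _ => 0) :
    ∀ᵐ z ∂volume.restrict unitDisk, w z ≤ 0 := by
  have hrot : ∀ N, ∀ᵐ z ∂volume.restrict unitDisk, rotAvg (cosKernel N) w z ≤ 0 := fun N =>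
    (h.rotationalAverage (continuous_cosKernel N)).ae_nonpos (rotAvg_nonneg (cosKernel_nonneg N) hf)
      fun ε hε => eventually_abs_rotAvg_cosKernel_le hb N hε
  -- Integrals of `w` against nonnegative kernels are nonpositive.
  have hint : ∀ ψ : ℂ → ℝ, Continuous ψ → (∀ z, 0 ≤ ψ z) → ∀ ρ < 1,
      (∀ z, z ∉ Metric.closedBall (0 : ℂ) ρ → ψ z = 0) → ∫ z, w z * ψ z ≤ 0 := by
    intro ψ hψ hψn ρ hρ hψ0
    have := nonpos_of_forall_integral_cosKernel_nonpos
      (continuous_integral_mul_comp_rotation h.left hψ hρ hψ0) fun N => by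
        rw [← integral_rotAvg_mul (continuous_cosKernel N) h.left hψ hρ hψ0]
        have e : ∫ z, rotAvg (cosKernel N) w z * ψ z =
            ∫ z in unitDisk, rotAvg (cosKernel N) w z * ψ z :=
          (setIntegral_eq_integral_of_forall_compl_eq_zero fun z hz => by
            rw [hψ0 z fun hz' => hz (Metric.closedBall_subset_ball hρ hz'), mul_zero]).symm
        rw [e]
        apply integral_nonpos_of_ae
        filter_upwards [hrot N] with z hz
        exact mul_nonpos_of_nonpos_of_nonneg hz (hψn z)
    simpa using this
  refine ae_unitDisk_of_forall_ball fun ρ hρ0 hρ1 => ?_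
  set R := (1 + ρ) / 2 with hR
  have hR1 : R < 1 := by rw [hR]; linarith
  have hρR : ρ < R := by rw [hR]; linarith
  set w₁ := (Metric.closedBall (0 : ℂ) R).indicator w with hw₁
  have hi : Integrable w₁ := LocallyIntegrableOn.integrable_indicator_closedBall h.left hR1
  rw [ae_restrict_iff' measurableSet_ball]
  filter_upwards [tendsto_mollify_ae hi.locallyIntegrable] with z hz hzρ
  rw [mem_ball_zero_iff] at hzρ
  have hzR : z ∈ Metric.closedBall (0 : ℂ) R := by
    rw [mem_closedBall_zero_iff]; linarith
  rw [hw₁, indicator_of_mem hzR] at hz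
  refine le_of_tendsto hz ?_
  filter_upwards [tendsto_originBump_rOut.eventually (gt_mem_nhds (sub_pos.mpr hρR))] with m hm
  rw [mollify_apply]
  have h0 := (isTestFunction_originBump_sub (m := m) (z := z) (by linarith)).2
  have hψ0 : ∀ y, y ∉ Metric.closedBall (0 : ℂ) R → (originBump m).normed volume (z - y) = 0 := by
    intro y hy
    rw [mem_closedBall_zero_iff, not_le] at hy
    exact h0 y (by linarith)
  refine le_trans (le_of_eq ?_) (hint (fun y => (originBump m).normed volume (z - y))
    ((originBump m).continuous_normed.comp (by fun_prop))
    (fun y => (originBump m).nonneg_normed _) R hR1 hψ0)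
  congr 1; ext y
  by_cases hy : y ∈ Metric.closedBall (0 : ℂ) R
  · rw [indicator_of_mem hy, mul_comm]
  · rw [hψ0 y hy]; simp

lemma hasWeakLaplacian_const (c : ℝ) : HasWeakLaplacian (fun _ => c) fun _ => 0 :=
  ContDiffOn.hasWeakLaplacian contDiffOn_const continuousOn_const fun z _ => by simp

/-- A solution of the Dirichlet problem with constant boundary values `n` is at most `n`. -/
lemma IsDirichletSolution.ae_le {H : ℂ → ℂ} {n : ℝ} {v : ℂ → ℝ}
    (hv : IsDirichletSolution H (fun _ => n) v) :
    ∀ᵐ z ∂volume.restrict unitDisk, v z ≤ n := by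
  have h := (isWeakSolution_iff.mp hv.weak).sub (hasWeakLaplacian_const n)
  have hb : HasBoundaryValues (fun z => v z - n) fun _ => 0 := by
    refine ⟨?_, fun φ hφ => ?_⟩
    · filter_upwards [hv.boundary.circleIntegrable] with r hr
      exact hr.sub (circleIntegrable_const n 0 r)
    · have h1 := (hv.boundary.tendsto φ hφ).sub_const
        (∫ θ in (0 : ℝ)..2 * Real.pi, φ (circleMap 0 1 θ) * n)
      rw [sub_self] at h1
      simp only [mul_zero, intervalIntegral.integral_zero]
      refine h1.congr' ?_
      filter_upwards [hv.boundary.circleIntegrable] with r hr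
      have hgc : Continuous fun β => φ (circleMap 0 1 β) :=
        hφ.comp_continuous (continuous_circleMap 0 1) fun β => circleMap_mem_sphere 0 zero_le_one β
      have hr' : IntervalIntegrable (fun β => v (circleMap 0 r β)) volume 0 (2 * Real.pi) := hr
      simp only [mul_sub]
      exact (intervalIntegral.integral_sub (hr'.continuousOn_mul hgc.continuousOn)
        ((hgc.mul continuous_const).intervalIntegrable _ _)).symm
  filter_upwards [h.ae_nonpos_of_hasBoundaryValues (fun z => by simp; positivity) hb] with z hz
  linarith

/-- A property of almost every point of the disk holds at almost every point of almost every
circle. -/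
lemma ae_circleMap_of_ae_unitDisk {P : ℂ → Prop} (h : ∀ᵐ z ∂volume.restrict unitDisk, P z) :
    ∀ᵐ r : ℝ, 0 < r → r < 1 →
      ∀ᵐ θ ∂volume.restrict (Ioo (-Real.pi) Real.pi), P (circleMap 0 r θ) := by
  rw [ae_restrict_iff' measurableSet_ball] at h
  set N := toMeasurable volume {z : ℂ | ¬ (z ∈ unitDisk → P z)} with hN
  have hNm : MeasurableSet N := measurableSet_toMeasurable _ _
  have hN0 : volume N = 0 := by rw [hN, measure_toMeasurable]; exact h
  have h1 := Complex.lintegral_comp_polarCoord_symm (N.indicator fun _ => 1)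
  rw [lintegral_indicator_const hNm, hN0, mul_zero] at h1
  have hc : Continuous fun p : ℝ × ℝ => circleMap 0 p.1 p.2 := by
    simp only [circleMap_zero]; fun_prop
  have hm : Measurable fun p : ℝ × ℝ => ENNReal.ofReal p.1 •
      (N.indicator (fun _ => (1 : ENNReal)) (circleMap 0 p.1 p.2)) := by
    simp only [smul_eq_mul]
    exact (ENNReal.measurable_ofReal.comp measurable_fst).mul
      ((measurable_const.indicator hNm).comp hc.measurable)
  simp only [polarCoord_symm_eq_circleMap] at h1
  rw [volume_restrict_polarCoord_target, lintegral_eq_zero_iff hm] at h1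
  have h2 := Measure.ae_ae_of_ae_prod h1
  rw [ae_restrict_iff' measurableSet_Ioi] at h2
  filter_upwards [h2] with r hr hr0 hr1
  filter_upwards [hr hr0] with θ hθ
  have hθ' : circleMap 0 r θ ∉ N := by
    intro hmem
    simp [hmem] at hθ
    linarith
  by_contra hP
  apply hθ'
  apply subset_toMeasurable
  intro hall
  apply hP
  apply hall
  rw [mem_ball_zero_iff]
  simp [circleMap_zero, abs_of_pos hr0, hr1]

lemma lintegral_circle_ofReal_eq {u : ℂ → ℝ} {r : ℝ} (hu : CircleIntegrable u 0 r)
    (h0 : ∀ᵐ θ ∂volume.restrict (Ioo (-Real.pi) Real.pi), 0 ≤ u (circleMap 0 r θ)) :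
    ∫⁻ θ in Ioo (-Real.pi) Real.pi, ENNReal.ofReal (u (circleMap 0 r θ)) =
      ENNReal.ofReal (∫ θ in (0 : ℝ)..2 * Real.pi, u (circleMap 0 r θ)) := by
  have hper : Function.Periodic (fun θ => u (circleMap 0 r θ)) (2 * Real.pi) := fun θ => by
    simp only [periodic_circleMap 0 r θ]
  have hi : IntervalIntegrable (fun θ => u (circleMap 0 r θ)) volume (-Real.pi) Real.pi := by
    have hu' : IntervalIntegrable (fun θ => u (circleMap 0 r θ)) volume 0 (0 + 2 * Real.pi) := by
      rw [zero_add]; exact hu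
    exact hper.intervalIntegrable (by linarith [Real.pi_pos]) hu' _ _
  have h1 := hper.intervalIntegral_add_eq 0 (-Real.pi)
  rw [zero_add, show -Real.pi + 2 * Real.pi = Real.pi by ring] at h1
  rw [h1, intervalIntegral.integral_of_le (by linarith [Real.pi_pos]),
    integral_Ioc_eq_integral_Ioo, ofReal_integral_eq_lintegral_ofReal _ h0]
  rw [intervalIntegrable_iff_integrableOn_Ioo_of_le (by linarith [Real.pi_pos])] at hi
  exact hi

/-- The Dirichlet problem with constant boundary values has at most one solution: the absolute
difference of two solutions is subharmonic and its circular means tend to zero. -/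
theorem IsDirichletSolution.ae_eq {H : ℂ → ℂ} {n : ℝ} {v u : ℂ → ℝ}
    (hv : IsDirichletSolution H (fun _ => n) v) (hu : IsDirichletSolution H (fun _ => n) u) :
    v =ᵐ[volume.restrict unitDisk] u := by
  have h := (isWeakSolution_iff.mp hv.weak).sub (isWeakSolution_iff.mp hu.weak)
  set w : ℂ → ℝ := fun z => v z - u z with hw
  have habs : LocallyIntegrableOn (fun z => |w z|) unitDisk :=
    LocallyIntegrableOn.comp_lipschitz (j := fun t => |t|) continuous_abs
      (fun a b => abs_abs_sub_abs_le _ _) h.left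
  have hmain := ae_eq_zero_of_setIntegral_ball_le habs (fun z => abs_nonneg _) ?_
  · filter_upwards [hmain] with z hz
    exact sub_eq_zero.mp (abs_eq_zero.mp hz)
  intro ρ hρ0 hρ1 ε' hε'
  have hpi := Real.pi_pos
  set ε := ε' / (2 * Real.pi) with hεdef
  have hε : 0 < ε := by positivity
  set q : ℂ → ℝ := fun z => √(w z ^ 2 + ε ^ 2) with hqdef
  have hqi : LocallyIntegrableOn q unitDisk := h.locallyIntegrableOn_sqrt hε
  -- The nonlinearity is monotone, so that `q` is subharmonic.
  have hsub : ∀ φ, IsTestFunction φ → (∀ z, 0 ≤ φ z) →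
      0 ≤ ∫ z, q z * Laplacian.laplacian φ z := by
    intro φ hφ hφ0
    refine le_trans (integral_nonneg fun z => ?_) (h.kato_sqrt hε hφ hφ0)
    refine mul_nonneg ?_ (hφ0 z)
    rw [← mul_sub, div_mul_eq_mul_div]
    refine div_nonneg ?_ (Real.sqrt_nonneg _)
    rw [mul_left_comm]
    refine mul_nonneg (sq_nonneg _) ?_
    simp only [hw]
    rcases le_total (u z) (v z) with hle | hle
    · exact mul_nonneg (by linarith) (sub_nonneg.mpr (Real.exp_le_exp.mpr (by linarith)))
    · exact mul_nonneg_of_nonpos_of_nonpos (by linarith)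
        (sub_nonpos.mpr (Real.exp_le_exp.mpr (by linarith)))
  -- Both solutions are at most `n`, so `|v - u| ≤ (n - v) + (n - u)`, whose circular means tend
  -- to zero.
  set g : ℂ → ℝ := fun z => 2 * n + ε - v z - u z with hg
  have hgb : ∀ᵐ z ∂volume.restrict unitDisk, q z ≤ g z := by
    filter_upwards [hv.ae_le, hu.ae_le] with z h1 h2
    refine (sqrt_sq_add_le hε _).trans ?_
    have : |w z| ≤ 2 * n - v z - u z := abs_le.mpr ⟨by simp only [hw]; linarith,
      by simp only [hw]; linarith⟩
    simp only [hg]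
    linarith
  have hlim : ∀ᶠ r : ℝ in 𝓝[<] 1,
      ∫ θ in (0 : ℝ)..2 * Real.pi, g (circleMap 0 r θ) ≤ 2 * Real.pi * (2 * ε) := by
    have t1 := hv.boundary.tendsto (fun _ => 1) continuousOn_const
    have t2 := hu.boundary.tendsto (fun _ => 1) continuousOn_const
    simp only [one_mul, intervalIntegral.integral_const, sub_zero, smul_eq_mul] at t1 t2
    have t3 := (tendsto_const_nhds (x := 2 * Real.pi * (2 * n + ε))).sub (t1.add t2)
    have hlt : 2 * Real.pi * (2 * n + ε) - (2 * Real.pi * n + 2 * Real.pi * n) <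
        2 * Real.pi * (2 * ε) := by nlinarith [mul_pos hpi hε]
    filter_upwards [(tendsto_order.mp t3).2 _ hlt, hv.boundary.circleIntegrable,
      hu.boundary.circleIntegrable] with r hr h1 h2
    have h1' : IntervalIntegrable (fun β => v (circleMap 0 r β)) volume 0 (2 * Real.pi) := h1
    have h2' : IntervalIntegrable (fun β => u (circleMap 0 r β)) volume 0 (2 * Real.pi) := h2
    refine le_trans (le_of_eq ?_) hr.le
    simp only [hg]
    rw [intervalIntegral.integral_sub (intervalIntegrable_const.sub h1') h2',
      intervalIntegral.integral_sub intervalIntegrable_const h1',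
      intervalIntegral.integral_const, smul_eq_mul, sub_zero]
    ring
  obtain ⟨r₀, hr₀0, hr₀, hr⟩ := exists_Ioo_of_eventually
    ((hlim.and hv.boundary.circleIntegrable).and hu.boundary.circleIntegrable)
  have hfin := setIntegral_ball_le_of_subharmonic hqi (fun z => Real.sqrt_nonneg _) hsub
    (M := 2 * ε) (by positivity) hr₀ (by
      filter_upwards [ae_circleMap_of_ae_unitDisk hgb] with r hgr h1 h2
      have hgr' := hgr (hr₀0.trans h1) h2
      obtain ⟨⟨hle, hvi⟩, hui⟩ := hr r h1 h2
      have hgi : CircleIntegrable g 0 r :=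
        ((circleIntegrable_const (2 * n + ε) 0 r).sub hvi).sub hui
      refine le_trans (lintegral_mono_ae (g := fun θ => ENNReal.ofReal (g (circleMap 0 r θ))) ?_) ?_
      · filter_upwards [hgr'] with θ hθ
        exact ENNReal.ofReal_le_ofReal hθ
      · rw [lintegral_circle_ofReal_eq hgi]
        · exact ENNReal.ofReal_le_ofReal hle
        · filter_upwards [hgr'] with θ hθ
          exact (Real.sqrt_nonneg _).trans hθ) hρ0.le hρ1
  have hi : ∀ {u : ℂ → ℝ}, LocallyIntegrableOn u unitDisk → IntegrableOn u (Metric.ball 0 ρ) :=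
    fun hu => (hu.integrableOn_compact_subset (Metric.closedBall_subset_ball hρ1)
      (isCompact_closedBall _ _)).mono_set Metric.ball_subset_closedBall
  calc ∫ z in Metric.ball 0 ρ, |w z| ≤ ∫ z in Metric.ball 0 ρ, q z :=
        setIntegral_mono (hi habs) (hi hqi) fun z => abs_le_sqrt_sq_add _ _
    _ ≤ Real.pi * (2 * ε) := hfin
    _ = ε' := by
        rw [hεdef]
        field_simp

/-! ### Explicit solutions from a bounded holomorphic function -/

/-- The function `log (2r / (1 - r²|I|²))`: the logarithm of the density of the pullback of the
Poincaré metric `2|dz| / (1 - |z|²)` under `rI`, divided by `|I'|`. -/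
noncomputable def pullbackSolution (I : ℂ → ℂ) (r : ℝ) (z : ℂ) : ℝ :=
  Real.log (2 * r / (1 - r ^ 2 * ‖I z‖ ^ 2))

section pullback

variable {I : ℂ → ℂ} {r : ℝ}

lemma pullbackSolution_denom_pos (hr0 : 0 < r) (hr1 : r ≤ 1) {z : ℂ} (hz : ‖I z‖ < 1) :
    0 < 1 - r ^ 2 * ‖I z‖ ^ 2 := by
  have h1 : r ^ 2 ≤ 1 := pow_le_one₀ hr0.le hr1
  have h2 : ‖I z‖ ^ 2 < 1 := pow_lt_one₀ (norm_nonneg _) hz (by norm_num)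
  nlinarith [sq_nonneg r, sq_nonneg ‖I z‖]

lemma exp_two_mul_pullbackSolution (hr0 : 0 < r) (hr1 : r ≤ 1) {z : ℂ} (hz : ‖I z‖ < 1) :
    Real.exp (2 * pullbackSolution I r z) = (2 * r / (1 - r ^ 2 * ‖I z‖ ^ 2)) ^ 2 := by
  have h := pullbackSolution_denom_pos hr0 hr1 hz
  rw [pullbackSolution, two_mul, Real.exp_add, Real.exp_log (by positivity), ← sq]

lemma contDiffOn_pullbackSolution (hI : DifferentiableOn ℂ I unitDisk)
    (hI1 : ∀ z ∈ unitDisk, ‖I z‖ < 1) (hr0 : 0 < r) (hr1 : r ≤ 1) :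
    ContDiffOn ℝ 2 (pullbackSolution I r) unitDisk := by
  intro z hz
  have h := pullbackSolution_denom_pos hr0 hr1 (hI1 z hz)
  have hc : ContDiffAt ℝ 2 I z := contDiffAt_of_differentiableOn Metric.isOpen_ball hI hz
  refine ContDiffAt.contDiffWithinAt ?_
  refine ContDiffAt.log (contDiffAt_const.div (contDiffAt_const.sub
    (contDiffAt_const.mul (hc.norm_sq ℝ))) h.ne') (by positivity)

lemma laplacian_pullbackSolution (hI : DifferentiableOn ℂ I unitDisk)
    (hI1 : ∀ z ∈ unitDisk, ‖I z‖ < 1) (hr0 : 0 < r) (hr1 : r ≤ 1) {z : ℂ} (hz : z ∈ unitDisk) :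
    Laplacian.laplacian (pullbackSolution I r) z =
      ‖deriv I z‖ ^ 2 * Real.exp (2 * pullbackSolution I r z) := by
  have hpos := pullbackSolution_denom_pos hr0 hr1 (hI1 z hz)
  have hJ : ∀ t, 0 < 1 - r ^ 2 * t → HasDerivAt (fun t => Real.log (2 * r / (1 - r ^ 2 * t)))
      (r ^ 2 / (1 - r ^ 2 * t)) t := by
    intro t ht
    have h1 : HasDerivAt (fun t => 1 - r ^ 2 * t) (-(r ^ 2)) t := by
      simpa using ((hasDerivAt_id t).const_mul (r ^ 2)).const_sub 1
    have h2 : HasDerivAt (fun t => 2 * r / (1 - r ^ 2 * t)) _ t :=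
      (hasDerivAt_const t (2 * r)).div h1 ht.ne'
    refine (h2.log (by positivity)).congr_deriv ?_
    field_simp
    ring
  have hJ' : HasDerivAt (fun t => r ^ 2 / (1 - r ^ 2 * t))
      (r ^ 4 / (1 - r ^ 2 * ‖I z‖ ^ 2) ^ 2) (‖I z‖ ^ 2) := by
    have h1 : HasDerivAt (fun t => 1 - r ^ 2 * t) (-(r ^ 2)) (‖I z‖ ^ 2) := by
      simpa using ((hasDerivAt_id (‖I z‖ ^ 2)).const_mul (r ^ 2)).const_sub 1
    have h2 := (hasDerivAt_const (‖I z‖ ^ 2) (r ^ 2)).div h1 hpos.ne'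
    refine h2.congr_deriv ?_
    ring
  have hev : ∀ᶠ t in 𝓝 (‖I z‖ ^ 2), 0 < 1 - r ^ 2 * t := by
    have : Continuous fun t : ℝ => 1 - r ^ 2 * t := by fun_prop
    exact this.continuousAt.eventually (lt_mem_nhds hpos)
  have hc : ContDiffAt ℝ 2 (fun x => ‖I x‖ ^ 2) z :=
    (contDiffAt_of_differentiableOn Metric.isOpen_ball hI hz).norm_sq ℝ
  have h := laplacian_comp_real hc (hev.mono hJ) hJ'
  rw [laplacian_norm_sq Metric.isOpen_ball hI hz,
    fderiv_norm_sq_sq_add (hI.differentiableAt (Metric.isOpen_ball.mem_nhds hz))] at h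
  rw [exp_two_mul_pullbackSolution hr0 hr1 (hI1 z hz)]
  refine h.trans ?_
  field_simp
  ring

lemma continuousOn_deriv_unitDisk (hI : DifferentiableOn ℂ I unitDisk) :
    ContinuousOn (deriv I) unitDisk :=
  (hI.deriv Metric.isOpen_ball).continuousOn

lemma isWeakSolution_pullbackSolution (hI : DifferentiableOn ℂ I unitDisk)
    (hI1 : ∀ z ∈ unitDisk, ‖I z‖ < 1) (hr0 : 0 < r) (hr1 : r ≤ 1) :
    IsWeakSolution (deriv I) (pullbackSolution I r) := by
  have hc := contDiffOn_pullbackSolution hI hI1 hr0 hr1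
  refine isWeakSolution_iff.mpr (hc.hasWeakLaplacian ?_ fun z hz =>
    laplacian_pullbackSolution hI hI1 hr0 hr1 hz)
  exact ((continuousOn_deriv_unitDisk hI).norm.pow 2).mul
    (continuousOn_const.mul hc.continuousOn).rexp

lemma log_two_mul_le_pullbackSolution (hr0 : 0 < r) (hr1 : r ≤ 1) {z : ℂ} (hz : ‖I z‖ < 1) :
    Real.log (2 * r) ≤ pullbackSolution I r z := by
  have h := pullbackSolution_denom_pos hr0 hr1 hz
  apply Real.log_le_log (by positivity)
  rw [le_div_iff₀ h]
  nlinarith [mul_nonneg hr0.le (mul_nonneg (sq_nonneg r) (sq_nonneg ‖I z‖))]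

lemma pullbackSolution_le (hr0 : 0 < r) (hr1 : r < 1) {z : ℂ} (hz : ‖I z‖ < 1) :
    pullbackSolution I r z ≤ Real.log (2 * r / (1 - r ^ 2)) := by
  have h := pullbackSolution_denom_pos hr0 hr1.le hz
  have h1 : r ^ 2 < 1 := pow_lt_one₀ hr0.le hr1 (by norm_num)
  have h2 : ‖I z‖ ^ 2 ≤ 1 := pow_le_one₀ (norm_nonneg _) hz.le
  apply Real.log_le_log (by positivity)
  apply div_le_div_of_nonneg_left (by positivity) (by linarith)
  nlinarith [sq_nonneg r]

lemma circleMap_mem_unitDisk {s : ℝ} (hs0 : 0 < s) (hs1 : s < 1) (θ : ℝ) :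
    circleMap 0 s θ ∈ unitDisk := by
  rw [mem_ball_zero_iff, norm_circleMap_zero, abs_of_pos hs0]
  exact hs1

/-- If the radial limits of `I` are unimodular almost everywhere, then the bounded function
`log (2r / (1 - r²|I|²))` has constant boundary values, by dominated convergence. -/
lemma hasBoundaryValues_pullbackSolution (hI : IsInnerFunction I)
    (hI1 : ∀ z ∈ unitDisk, ‖I z‖ < 1) (hr0 : 0 < r) (hr1 : r < 1) :
    HasBoundaryValues (pullbackSolution I r) fun _ => Real.log (2 * r / (1 - r ^ 2)) := by
  have hc : ContinuousOn (pullbackSolution I r) unitDisk :=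
    (contDiffOn_pullbackSolution hI.holo hI1 hr0 hr1.le).continuousOn
  have hIoo : Ioo (0 : ℝ) 1 ∈ 𝓝[<] (1 : ℝ) := Ioo_mem_nhdsLT one_pos
  have hcirc : ∀ s ∈ Ioo (0 : ℝ) 1, Continuous fun θ => pullbackSolution I r (circleMap 0 s θ) :=
    fun s hs => hc.comp_continuous (continuous_circleMap 0 s)
      fun θ => circleMap_mem_unitDisk hs.1 hs.2 θ
  refine ⟨?_, fun φ hφ => ?_⟩
  · filter_upwards [hIoo] with s hs
    exact (hcirc s hs).intervalIntegrable _ _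
  have hgc : Continuous fun θ => φ (circleMap 0 1 θ) :=
    hφ.comp_continuous (continuous_circleMap 0 1) fun β => circleMap_mem_sphere 0 zero_le_one β
  set B := |Real.log (2 * r)| + |Real.log (2 * r / (1 - r ^ 2))| with hB
  refine intervalIntegral.tendsto_integral_filter_of_dominated_convergence
    (fun θ => |φ (circleMap 0 1 θ)| * B) ?_ ?_ ?_ ?_
  · filter_upwards [hIoo] with s hs
    exact (hgc.mul (hcirc s hs)).aestronglyMeasurable
  · filter_upwards [hIoo] with s hs
    refine Eventually.of_forall fun θ _ => ?_
    rw [norm_mul]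
    refine mul_le_mul_of_nonneg_left ?_ (norm_nonneg _)
    have hz := hI1 _ (circleMap_mem_unitDisk hs.1 hs.2 θ)
    have h1 := log_two_mul_le_pullbackSolution hr0 hr1.le hz
    have h2 := pullbackSolution_le hr0 hr1 hz
    rw [Real.norm_eq_abs, abs_le]
    constructor
    · linarith [neg_abs_le (Real.log (2 * r)), abs_nonneg (Real.log (2 * r / (1 - r ^ 2)))]
    · linarith [le_abs_self (Real.log (2 * r / (1 - r ^ 2))), abs_nonneg (Real.log (2 * r))]
  · exact (hgc.abs.mul continuous_const).intervalIntegrable _ _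
  · filter_upwards [hI.radial] with θ hθ _
    obtain ⟨w, hw, hlim⟩ := hθ
    have h1 : 1 - r ^ 2 ≠ 0 := by
      have : r ^ 2 < 1 := pow_lt_one₀ hr0.le hr1 (by norm_num)
      linarith
    have h2 : Tendsto (fun s : ℝ => 1 - r ^ 2 * ‖I (circleMap 0 s θ)‖ ^ 2) (𝓝[<] 1)
        (𝓝 (1 - r ^ 2)) := by
      have := ((hlim.norm.pow 2).const_mul (r ^ 2)).const_sub 1
      simpa [hw] using this
    exact ((tendsto_const_nhds.div h2 h1).log (by positivity)).const_mul _

end pullback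

/-! ### Inner functions and the Bergman space -/

lemma norm_lt_one_of_not_const {I : ℂ → ℂ} (hI : IsInnerFunction I)
    (hnc : ¬ ∃ c : ℂ, ∀ z ∈ unitDisk, I z = c) : ∀ z ∈ unitDisk, ‖I z‖ < 1 := by
  intro z hz
  refine lt_of_le_of_ne (hI.norm_le_one z hz) fun h1 => hnc ⟨I z, fun x hx => ?_⟩
  exact Complex.eqOn_of_isPreconnected_of_isMaxOn_norm (convex_ball 0 1).isPreconnected
    Metric.isOpen_ball hI.holo hz (fun y hy => by
      simpa [h1] using hI.norm_le_one y hy) hx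

lemma exists_deriv_ne_zero_of_not_const {I : ℂ → ℂ} (hI : DifferentiableOn ℂ I unitDisk)
    (hnc : ¬ ∃ c : ℂ, ∀ z ∈ unitDisk, I z = c) : ∃ z ∈ unitDisk, deriv I z ≠ 0 := by
  by_contra! h
  exact hnc (Metric.isOpen_ball.exists_is_const_of_deriv_eq_zero (convex_ball 0 1).isPreconnected
    hI h)

/-- The bound does not depend on `ε`: the equation `Δu = |I'|² e^{2u}`, with `0 ≤ u ≤ 1`, is tested
against `radialTest ε`, whose Laplacian has a positive part of bounded mass. -/
lemma integral_norm_deriv_sq_mul_radialTest_le {I : ℂ → ℂ} (hI : DifferentiableOn ℂ I unitDisk)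
    (hI1 : ∀ z ∈ unitDisk, ‖I z‖ < 1) {ε : ℝ} (hε : 0 < ε) :
    ∫ z, ‖deriv I z‖ ^ 2 * radialTest ε z ≤ 4 * Real.pi := by
  have hr0 : (0 : ℝ) < 1 / 2 := by norm_num
  have hr1 : (1 / 2 : ℝ) < 1 := by norm_num
  -- Test the equation of the bounded solution `log (1 / (1 - |I|² / 4))`.
  set u := pullbackSolution I (1 / 2) with hu
  have hw := isWeakSolution_iff.mp (isWeakSolution_pullbackSolution hI hI1 hr0 hr1.le)
  have hφ := isTestFunction_radialTest hε
  have hl : LocallyIntegrableOn (fun z => ‖deriv I z‖ ^ 2) unitDisk :=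
    ((continuousOn_deriv_unitDisk hI).norm.pow 2).locallyIntegrableOn measurableSet_ball
  have hu0 : ∀ z ∈ unitDisk, 0 ≤ u z := fun z hz => by
    have := log_two_mul_le_pullbackSolution hr0 hr1.le (hI1 z hz)
    norm_num at this
    simpa [hu] using this
  have hu1 : ∀ z ∈ unitDisk, u z ≤ 1 := fun z hz => by
    refine (pullbackSolution_le hr0 hr1 (hI1 z hz)).trans ?_
    refine (Real.log_le_sub_one_of_pos (by norm_num)).trans (by norm_num)
  have hout : ∀ z, z ∉ unitDisk → 1 - ‖z‖ ^ 2 < ε := fun z hz => by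
    rw [mem_ball_zero_iff, not_lt] at hz
    nlinarith
  have iw := integrable_mul_radialWeight hε hw.left
  calc ∫ z, ‖deriv I z‖ ^ 2 * radialTest ε z
      ≤ ∫ z, ‖deriv I z‖ ^ 2 * Real.exp (2 * u z) * radialTest ε z := by
        refine integral_mono (hφ.integrable_mul hl) (hφ.integrable_mul hw.right) fun z => ?_
        by_cases hz : z ∈ unitDisk
        · refine mul_le_mul_of_nonneg_right ?_ (radialRamp_nonneg hε _)
          exact le_mul_of_one_le_right (sq_nonneg _) (Real.one_le_exp (by linarith [hu0 z hz]))
        · simp [hφ.eq_zero hz]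
    _ = ∫ z, u z * Laplacian.laplacian (radialTest ε) z := (hw.weak_eq _ hφ).symm
    _ = 4 * (∫ z, u z * radialWeight ε z) - 4 * ∫ z, u z * radialCutoff ε z :=
        integral_mul_laplacian_radialTest hε hw.left
    _ ≤ 4 * Real.pi := by
        have h1 : 0 ≤ ∫ z, u z * radialCutoff ε z := by
          refine integral_nonneg fun z => ?_
          by_cases hz : z ∈ unitDisk
          · exact mul_nonneg (hu0 z hz) (radialCutoff_nonneg z)
          · simp [radialCutoff_eq_zero hε z (hout z hz)]
        have h2 : ∫ z, u z * radialWeight ε z ≤ ∫ z, radialWeight ε z := by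
          refine integral_mono iw (integrable_radialWeight hε) fun z => ?_
          by_cases hz : z ∈ unitDisk
          · exact mul_le_of_le_one_left (radialWeight_nonneg hε z) (hu1 z hz)
          · simp [radialWeight_eq_zero hε z (hout z hz)]
        linarith [integral_radialWeight_le hε]

/-- The derivative of a bounded holomorphic function lies in the weighted Bergman space `A²₁`. -/
lemma memBergman_deriv {I : ℂ → ℂ} (hI : DifferentiableOn ℂ I unitDisk)
    (hI1 : ∀ z ∈ unitDisk, ‖I z‖ < 1) : MemBergman (deriv I) := by
  have hdc := continuousOn_deriv_unitDisk hI
  have hc : ContinuousOn (fun z => ‖deriv I z‖ ^ 2 * (1 - ‖z‖)) unitDisk :=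
    (hdc.norm.pow 2).mul (by fun_prop)
  have hm := hc.aestronglyMeasurable (μ := volume) measurableSet_ball
  refine ⟨hI.deriv Metric.isOpen_ball, hm, ?_⟩
  set ε : ℕ → ℝ := fun n => 1 / ((n : ℝ) + 1) with hεdef
  have hε : ∀ n, 0 < ε n := fun n => by positivity
  have hε0 : Tendsto ε atTop (𝓝 0) := tendsto_one_div_add_atTop_nhds_zero_nat
  have hlim : ∀ z, Tendsto (fun n => ENNReal.ofReal (‖deriv I z‖ ^ 2 * (1 - ‖z‖ - 2 * ε n))) atTop
      (𝓝 (ENNReal.ofReal (‖deriv I z‖ ^ 2 * (1 - ‖z‖)))) := by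
    intro z
    apply ENNReal.tendsto_ofReal
    simpa using ((hε0.const_mul 2).const_sub (1 - ‖z‖)).const_mul (‖deriv I z‖ ^ 2)
  have hbound : ∀ n, ∫⁻ z in unitDisk, ENNReal.ofReal (‖deriv I z‖ ^ 2 * (1 - ‖z‖ - 2 * ε n)) ≤
      ENNReal.ofReal (4 * Real.pi) := by
    intro n
    have hi : Integrable (fun z => ‖deriv I z‖ ^ 2 * radialTest (ε n) z) :=
      (isTestFunction_radialTest (hε n)).integrable_mul
        ((hdc.norm.pow 2).locallyIntegrableOn measurableSet_ball)
    have hn : ∀ z, 0 ≤ ‖deriv I z‖ ^ 2 * radialTest (ε n) z := fun z =>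
      mul_nonneg (sq_nonneg _) (radialRamp_nonneg (hε n) _)
    calc ∫⁻ z in unitDisk, ENNReal.ofReal (‖deriv I z‖ ^ 2 * (1 - ‖z‖ - 2 * ε n))
        ≤ ∫⁻ z in unitDisk, ENNReal.ofReal (‖deriv I z‖ ^ 2 * radialTest (ε n) z) := by
          refine setLIntegral_mono' measurableSet_ball fun z hz => ?_
          rw [mem_ball_zero_iff] at hz
          apply ENNReal.ofReal_le_ofReal
          refine mul_le_mul_of_nonneg_left ?_ (sq_nonneg _)
          refine le_trans ?_ (sub_le_radialRamp (hε n) _)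
          nlinarith [norm_nonneg z]
      _ ≤ ∫⁻ z, ENNReal.ofReal (‖deriv I z‖ ^ 2 * radialTest (ε n) z) :=
          setLIntegral_le_lintegral _ _
      _ = ENNReal.ofReal (∫ z, ‖deriv I z‖ ^ 2 * radialTest (ε n) z) :=
          (ofReal_integral_eq_lintegral_ofReal hi (Eventually.of_forall hn)).symm
      _ ≤ ENNReal.ofReal (4 * Real.pi) :=
          ENNReal.ofReal_le_ofReal (integral_norm_deriv_sq_mul_radialTest_le hI hI1 (hε n))
  -- Let `ε → 0` with Fatou's lemma.
  have hfatou : ∫⁻ z in unitDisk, ENNReal.ofReal (‖deriv I z‖ ^ 2 * (1 - ‖z‖)) ≤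
      ENNReal.ofReal (4 * Real.pi) := by
    calc ∫⁻ z in unitDisk, ENNReal.ofReal (‖deriv I z‖ ^ 2 * (1 - ‖z‖))
        = ∫⁻ z in unitDisk, liminf (fun n =>
            ENNReal.ofReal (‖deriv I z‖ ^ 2 * (1 - ‖z‖ - 2 * ε n))) atTop := by
          congr 1; ext z
          exact (hlim z).liminf_eq.symm
      _ ≤ liminf (fun n => ∫⁻ z in unitDisk,
            ENNReal.ofReal (‖deriv I z‖ ^ 2 * (1 - ‖z‖ - 2 * ε n))) atTop := by
          apply lintegral_liminf_le'
          intro n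
          apply AEMeasurable.ennreal_ofReal
          exact (ContinuousOn.aemeasurable ((hdc.norm.pow 2).mul (by fun_prop)) measurableSet_ball)
      _ ≤ ENNReal.ofReal (4 * Real.pi) :=
          liminf_le_of_le (by isBoundedDefault) fun b hb => by
            obtain ⟨n, hn⟩ := hb.exists
            exact hn.trans (hbound n)
  rw [hasFiniteIntegral_iff_ofReal]
  · exact hfatou.trans_lt ENNReal.ofReal_lt_top
  · rw [EventuallyLE, ae_restrict_iff' measurableSet_ball]
    refine Eventually.of_forall fun z hz => ?_
    rw [mem_ball_zero_iff] at hz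
    exact mul_nonneg (sq_nonneg _) (by linarith)

/-! ### The solutions with constant boundary values -/

/-- The radius `r` with `2r / (1 - r²) = e^n`. -/
noncomputable def boundaryRadius (n : ℝ) : ℝ := √(1 + Real.exp (-n) ^ 2) - Real.exp (-n)

lemma boundaryRadius_pos (n : ℝ) : 0 < boundaryRadius n := by
  rw [boundaryRadius, sub_pos]
  apply Real.lt_sqrt_of_sq_lt
  linarith

lemma boundaryRadius_lt_one (n : ℝ) : boundaryRadius n < 1 := by
  have h := Real.exp_pos (-n)
  rw [boundaryRadius, sub_lt_iff_lt_add, Real.sqrt_lt' (by linarith)]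
  nlinarith

lemma log_boundaryRadius (n : ℝ) :
    Real.log (2 * boundaryRadius n / (1 - boundaryRadius n ^ 2)) = n := by
  have h := Real.exp_pos (-n)
  have hr := boundaryRadius_pos n
  have hs : √(1 + Real.exp (-n) ^ 2) ^ 2 = 1 + Real.exp (-n) ^ 2 := Real.sq_sqrt (by positivity)
  have e : 1 - boundaryRadius n ^ 2 = 2 * Real.exp (-n) * boundaryRadius n := by
    rw [boundaryRadius]
    linear_combination -hs
  rw [e, show 2 * boundaryRadius n / (2 * Real.exp (-n) * boundaryRadius n) =
    (Real.exp (-n))⁻¹ by field_simp, ← Real.exp_neg, neg_neg, Real.log_exp]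

lemma tendsto_boundaryRadius : Tendsto boundaryRadius atTop (𝓝 1) := by
  have h1 : Tendsto (fun n : ℝ => Real.exp (-n)) atTop (𝓝 0) := Real.tendsto_exp_neg_atTop_nhds_zero
  have h2 := (((h1.pow 2).const_add 1).sqrt).sub h1
  have e : boundaryRadius = fun n => √(1 + Real.exp (-n) ^ 2) - Real.exp (-n) := rfl
  rw [e]
  simpa using h2

/-- The solution with boundary values `n` associated with an inner function. -/
lemma isDirichletSolution_pullbackSolution {I : ℂ → ℂ} (hI : IsInnerFunction I)
    (hI1 : ∀ z ∈ unitDisk, ‖I z‖ < 1) (n : ℝ) :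
    IsDirichletSolution (deriv I) (fun _ => n) (pullbackSolution I (boundaryRadius n)) := by
  refine ⟨isWeakSolution_pullbackSolution hI.holo hI1 (boundaryRadius_pos n)
    (boundaryRadius_lt_one n).le, ?_⟩
  have := hasBoundaryValues_pullbackSolution hI hI1 (boundaryRadius_pos n) (boundaryRadius_lt_one n)
  rwa [log_boundaryRadius] at this

lemma continuousOn_pullbackSolution {I : ℂ → ℂ} (hI : IsInnerFunction I)
    (hI1 : ∀ z ∈ unitDisk, ‖I z‖ < 1) (n : ℝ) :
    ContinuousOn (pullbackSolution I (boundaryRadius n)) unitDisk :=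
  (contDiffOn_pullbackSolution hI.holo hI1 (boundaryRadius_pos n)
    (boundaryRadius_lt_one n).le).continuousOn

lemma tendsto_pullbackSolution {I : ℂ → ℂ} (hI1 : ∀ z ∈ unitDisk, ‖I z‖ < 1) {z : ℂ}
    (hz : z ∈ unitDisk) :
    Tendsto (fun n => pullbackSolution I (boundaryRadius n) z) atTop
      (𝓝 (Real.log (2 / (1 - ‖I z‖ ^ 2)))) := by
  have hd := pullbackSolution_denom_pos one_pos le_rfl (hI1 z hz)
  rw [one_pow, one_mul] at hd
  have h1 : Tendsto (fun n => 1 - boundaryRadius n ^ 2 * ‖I z‖ ^ 2) atTop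
      (𝓝 (1 - ‖I z‖ ^ 2)) := by
    simpa using ((tendsto_boundaryRadius.pow 2).mul_const (‖I z‖ ^ 2)).const_sub 1
  have h2 := ((tendsto_boundaryRadius.const_mul 2).div h1 hd.ne').log
    (by rw [mul_one]; positivity)
  rw [mul_one] at h2
  exact h2

/-- Continuous solutions of the Dirichlet problem are unique at every point of the disk. -/
lemma IsDirichletSolution.eqOn {H : ℂ → ℂ} {n : ℝ} {v u : ℂ → ℝ}
    (hv : IsDirichletSolution H (fun _ => n) v) (hu : IsDirichletSolution H (fun _ => n) u)
    (hvc : ContinuousOn v unitDisk) (huc : ContinuousOn u unitDisk) : EqOn v u unitDisk :=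
  Measure.eqOn_open_of_ae_eq (hv.ae_eq hu) Metric.isOpen_ball hvc huc

/-! ### Disk automorphisms -/

/-- The Möbius transformation `w ↦ (w - a) / (1 - conj a * w)` of the unit disk. -/
noncomputable def diskMobius (a w : ℂ) : ℂ := (w - a) / (1 - starRingEnd ℂ a * w)

lemma normSq_one_sub_conj_mul_sub (a w : ℂ) :
    Complex.normSq (1 - starRingEnd ℂ a * w) - Complex.normSq (w - a) =
      (1 - Complex.normSq a) * (1 - Complex.normSq w) := by
  simp [Complex.normSq_apply]
  ring

section mobius

variable {a w : ℂ}

lemma normSq_lt_one_of_mem_unitDisk (ha : a ∈ unitDisk) : Complex.normSq a < 1 := by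
  rw [mem_ball_zero_iff] at ha
  rw [← Complex.sq_norm]
  exact pow_lt_one₀ (norm_nonneg _) ha (by norm_num)

lemma one_sub_conj_mul_ne_zero (ha : a ∈ unitDisk) (hw : w ∈ unitDisk) :
    1 - starRingEnd ℂ a * w ≠ 0 := by
  intro h
  have h1 := normSq_one_sub_conj_mul_sub a w
  rw [h, map_zero] at h1
  have h2 := mul_pos (sub_pos.mpr (normSq_lt_one_of_mem_unitDisk ha))
    (sub_pos.mpr (normSq_lt_one_of_mem_unitDisk hw))
  linarith [Complex.normSq_nonneg (w - a)]

lemma diskMobius_mem (ha : a ∈ unitDisk) (hw : w ∈ unitDisk) : diskMobius a w ∈ unitDisk := by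
  have h0 := one_sub_conj_mul_ne_zero ha hw
  rw [mem_ball_zero_iff, diskMobius, norm_div, div_lt_one (norm_pos_iff.mpr h0)]
  refine lt_of_pow_lt_pow_left₀ 2 (norm_nonneg _) ?_
  rw [Complex.sq_norm, Complex.sq_norm]
  have h1 := normSq_one_sub_conj_mul_sub a w
  have h2 := mul_pos (sub_pos.mpr (normSq_lt_one_of_mem_unitDisk ha))
    (sub_pos.mpr (normSq_lt_one_of_mem_unitDisk hw))
  linarith

lemma neg_mem_unitDisk (ha : a ∈ unitDisk) : -a ∈ unitDisk := by simpa using ha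

lemma diskMobius_neg_diskMobius (ha : a ∈ unitDisk) (hw : w ∈ unitDisk) :
    diskMobius (-a) (diskMobius a w) = w := by
  have h0 := one_sub_conj_mul_ne_zero ha hw
  have h1 : (1 : ℂ) - starRingEnd ℂ a * a ≠ 0 := one_sub_conj_mul_ne_zero ha ha
  have h2 := one_sub_conj_mul_ne_zero (neg_mem_unitDisk ha) (diskMobius_mem ha hw)
  rw [diskMobius, div_eq_iff h2, diskMobius, map_neg]
  have h3 : 1 - w * starRingEnd ℂ a ≠ 0 := by rwa [mul_comm]
  field_simp
  ring

lemma isDiskAutomorphism_diskMobius (ha : a ∈ unitDisk) : IsDiskAutomorphism (diskMobius a) := by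
  refine ⟨?_, InvOn.bijOn (f' := diskMobius (-a)) ⟨fun w hw => diskMobius_neg_diskMobius ha hw,
    fun w hw => ?_⟩ (fun w hw => diskMobius_mem ha hw)
    fun w hw => diskMobius_mem (neg_mem_unitDisk ha) hw⟩
  · intro w hw
    have h0 := one_sub_conj_mul_ne_zero ha hw
    unfold diskMobius
    have h1 : DifferentiableAt ℂ (fun x : ℂ => x - a) w := by fun_prop
    have h2 : DifferentiableAt ℂ (fun x => 1 - starRingEnd ℂ a * x) w := by fun_prop
    exact (h1.div h2 h0).differentiableWithinAt
  · have := diskMobius_neg_diskMobius (neg_mem_unitDisk ha) hw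
    rwa [neg_neg] at this

lemma isDiskAutomorphism_mul {c : ℂ} (hc : ‖c‖ = 1) : IsDiskAutomorphism fun w => c * w := by
  have hc0 : c ≠ 0 := by
    rintro rfl
    simp at hc
  refine ⟨by fun_prop, InvOn.bijOn (f' := fun w => c⁻¹ * w) ⟨fun w _ => ?_, fun w _ => ?_⟩ ?_ ?_⟩
  · simp [hc0]
  · simp [hc0]
  · intro w hw
    simpa [hc] using hw
  · intro w hw
    simpa [hc] using hw

lemma IsDiskAutomorphism.comp {σ τ : ℂ → ℂ} (hσ : IsDiskAutomorphism σ)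
    (hτ : IsDiskAutomorphism τ) : IsDiskAutomorphism (σ ∘ τ) :=
  ⟨hσ.holo.comp hτ.holo hτ.bijOn.mapsTo, hσ.bijOn.comp hτ.bijOn⟩

lemma hasDerivAt_diskMobius_comp {f : ℂ → ℂ} {z : ℂ} (hf : DifferentiableAt ℂ f z)
    (ha : a ∈ unitDisk) (hfz : f z ∈ unitDisk) :
    HasDerivAt (fun x => diskMobius a (f x))
      (deriv f z * (1 - starRingEnd ℂ a * a) / (1 - starRingEnd ℂ a * f z) ^ 2) z := by
  have h0 := one_sub_conj_mul_ne_zero ha hfz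
  have h1 : HasDerivAt (fun x => (f x - a) / (1 - starRingEnd ℂ a * f x)) _ z :=
    (hf.hasDerivAt.sub_const a).div ((hf.hasDerivAt.const_mul (starRingEnd ℂ a)).const_sub 1) h0
  refine HasDerivAt.congr_deriv (f := fun x => diskMobius a (f x)) h1 ?_
  congr 1
  ring

end mobius

/-! ### Polarization -/

/-- If `∑ pⱼ conj qⱼ` vanishes on an open set, so does its Wirtinger derivative `∑ p'ⱼ conj qⱼ`. -/
lemma sum_deriv_mul_conj_eq_zero {ι : Type*} [Fintype ι] {p q : ι → ℂ → ℂ} {V : Set ℂ}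
    (hV : IsOpen V) (hp : ∀ j, DifferentiableOn ℂ (p j) V) (hq : ∀ j, DifferentiableOn ℂ (q j) V)
    (h : ∀ z ∈ V, ∑ j, p j z * starRingEnd ℂ (q j z) = 0) :
    ∀ z ∈ V, ∑ j, deriv (p j) z * starRingEnd ℂ (q j z) = 0 := by
  intro z hz
  have hpd : ∀ j, HasDerivAt (p j) (deriv (p j) z) z := fun j =>
    ((hp j).differentiableAt (hV.mem_nhds hz)).hasDerivAt
  have hqd : ∀ j, HasDerivAt (q j) (deriv (q j) z) z := fun j =>
    ((hq j).differentiableAt (hV.mem_nhds hz)).hasDerivAt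
  -- The derivative in the direction `v` vanishes for `v = 1` and `v = i`.
  have key : ∀ v : ℂ, ∑ j, (deriv (p j) z * v * starRingEnd ℂ (q j z) +
      p j z * starRingEnd ℂ (deriv (q j) z * v)) = 0 := by
    intro v
    have hline : HasDerivAt (fun t : ℝ => z + t * v) v 0 := by
      simpa using (((hasDerivAt_id (0 : ℝ)).ofReal_comp).mul_const v).const_add z
    have hz0 : z + ((0 : ℝ) : ℂ) * v = z := by simp
    have h1 : HasDerivAt (fun t : ℝ => ∑ j, p j (z + t * v) * starRingEnd ℂ (q j (z + t * v)))
        (∑ j, (deriv (p j) z * v * starRingEnd ℂ (q j z) +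
          p j z * starRingEnd ℂ (deriv (q j) z * v))) 0 := by
      refine HasDerivAt.fun_sum fun j _ => ?_
      have a1 : HasDerivAt (fun t : ℝ => p j (z + t * v)) (deriv (p j) z * v) 0 :=
        HasDerivAt.comp (h₂ := p j) (0 : ℝ) (by rw [hz0]; exact hpd j) hline
      have a2 : HasDerivAt (fun t : ℝ => q j (z + t * v)) (deriv (q j) z * v) 0 :=
        HasDerivAt.comp (h₂ := q j) (0 : ℝ) (by rw [hz0]; exact hqd j) hline
      have a3 := a1.mul a2.star
      simp only [hz0] at a3
      exact a3
    have h2 : (fun t : ℝ => ∑ j, p j (z + t * v) * starRingEnd ℂ (q j (z + t * v))) =ᶠ[𝓝 0]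
        fun _ => 0 := by
      have : ∀ᶠ t : ℝ in 𝓝 0, z + t * v ∈ V := by
        apply hline.continuousAt.eventually
        change ∀ᶠ y in 𝓝 (z + ((0 : ℝ) : ℂ) * v), y ∈ V
        rw [hz0]
        exact hV.mem_nhds hz
      filter_upwards [this] with t ht
      exact h _ ht
    exact h1.unique ((hasDerivAt_const (0 : ℝ) (0 : ℂ)).congr_of_eventuallyEq h2)
  have k1 := key 1
  have kI := key Complex.I
  simp only [Finset.sum_add_distrib, mul_one, map_mul, Complex.conj_I] at k1 kI
  have e1 : ∑ j, deriv (p j) z * Complex.I * starRingEnd ℂ (q j z) =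
      Complex.I * ∑ j, deriv (p j) z * starRingEnd ℂ (q j z) := by
    rw [Finset.mul_sum]; congr 1; ext j; ring
  have e2 : ∑ j, p j z * (starRingEnd ℂ (deriv (q j) z) * -Complex.I) =
      -Complex.I * ∑ j, p j z * starRingEnd ℂ (deriv (q j) z) := by
    rw [Finset.mul_sum]; congr 1; ext j; ring
  rw [e1, e2] at kI
  linear_combination (1 / 2 : ℂ) * k1 - Complex.I / 2 * kI +
    (1 / 2 : ℂ) * (∑ j, deriv (p j) z * starRingEnd ℂ (q j z) -
      ∑ j, p j z * starRingEnd ℂ (deriv (q j) z)) * Complex.I_sq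

lemma differentiableOn_iteratedDeriv {f : ℂ → ℂ} {V : Set ℂ} (hV : IsOpen V)
    (hf : DifferentiableOn ℂ f V) (m : ℕ) : DifferentiableOn ℂ (iteratedDeriv m f) V := by
  induction m with
  | zero => simpa using hf
  | succ m ih => rw [iteratedDeriv_succ]; exact ih.deriv hV

lemma sum_iteratedDeriv_mul_conj_eq_zero {ι : Type*} [Fintype ι] {p q : ι → ℂ → ℂ} {V : Set ℂ}
    (hV : IsOpen V) (hp : ∀ j, DifferentiableOn ℂ (p j) V) (hq : ∀ j, DifferentiableOn ℂ (q j) V)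
    (h : ∀ z ∈ V, ∑ j, p j z * starRingEnd ℂ (q j z) = 0) (m : ℕ) :
    ∀ z ∈ V, ∑ j, iteratedDeriv m (p j) z * starRingEnd ℂ (q j z) = 0 := by
  induction m with
  | zero => simpa using h
  | succ m ih =>
    simp only [iteratedDeriv_succ]
    exact sum_deriv_mul_conj_eq_zero hV (fun j => differentiableOn_iteratedDeriv hV (hp j) m) hq ih

/-- **Polarization**: if `∑ pⱼ conj qⱼ` vanishes on the diagonal near `w`, then
`∑ pⱼ(z) conj (qⱼ(w))` vanishes for all `z` in the disk, all its derivatives at `w` being zero. -/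
lemma sum_mul_conj_eq_zero_of_diagonal {ι : Type*} [Fintype ι] {p q : ι → ℂ → ℂ} {V : Set ℂ}
    (hV : IsOpen V) (hVD : V ⊆ unitDisk) (hp : ∀ j, DifferentiableOn ℂ (p j) unitDisk)
    (hq : ∀ j, DifferentiableOn ℂ (q j) unitDisk)
    (h : ∀ z ∈ V, ∑ j, p j z * starRingEnd ℂ (q j z) = 0) {w : ℂ} (hw : w ∈ V) :
    ∀ z ∈ unitDisk, ∑ j, p j z * starRingEnd ℂ (q j w) = 0 := by
  set G : ℂ → ℂ := fun z => ∑ j, p j z * starRingEnd ℂ (q j w) with hG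
  have hGd : DifferentiableOn ℂ G unitDisk :=
    DifferentiableOn.fun_sum fun j _ => (hp j).mul_const _
  have hGa : AnalyticOnNhd ℂ G unitDisk := hGd.analyticOnNhd Metric.isOpen_ball
  have hwD := hVD hw
  have hder : ∀ m, iteratedDeriv m G w = 0 := by
    intro m
    rw [← sum_iteratedDeriv_mul_conj_eq_zero hV (fun j => (hp j).mono hVD)
      (fun j => (hq j).mono hVD) h m w hw, hG, iteratedDeriv_fun_sum]
    · congr 1; ext j
      have : (fun z => p j z * starRingEnd ℂ (q j w)) =
          fun z => starRingEnd ℂ (q j w) * p j z := by ext; ring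
      rw [this, iteratedDeriv_const_mul_field, mul_comm]
    · intro j _
      exact (((hp j).mul_const _).contDiffOn Metric.isOpen_ball).contDiffAt
        (Metric.isOpen_ball.mem_nhds hwD)
  have hzero : G =ᶠ[𝓝 w] 0 := by
    have : analyticOrderAt G w = ⊤ := by
      rw [ENat.eq_top_iff_forall_ge]
      intro m
      rw [natCast_le_analyticOrderAt_iff_iteratedDeriv_eq_zero (hGa w hwD)]
      exact fun i _ => hder i
    exact analyticOrderAt_eq_top.mp this
  exact hGa.eqOn_zero_of_preconnected_of_eventuallyEq_zero (convex_ball 0 1).isPreconnected hwD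
    hzero

/-! ### Uniqueness of the Liouville map -/

/-- The polarized form of `|F'|² (1 - |I|²)² = |I'|² (1 - |F|²)²`. -/
lemma deriv_mul_conj_eq_of_norm_eq {I F : ℂ → ℂ} (hI : DifferentiableOn ℂ I unitDisk)
    (hF : DifferentiableOn ℂ F unitDisk) {V : Set ℂ} (hV : IsOpen V) (hVD : V ⊆ unitDisk)
    (h : ∀ z ∈ V, ‖deriv F z‖ * (1 - ‖I z‖ ^ 2) = ‖deriv I z‖ * (1 - ‖F z‖ ^ 2)) {w : ℂ}
    (hw : w ∈ V) : ∀ z ∈ unitDisk,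
      deriv F z * starRingEnd ℂ (deriv F w) * (1 - starRingEnd ℂ (I w) * I z) ^ 2 =
        deriv I z * starRingEnd ℂ (deriv I w) * (1 - starRingEnd ℂ (F w) * F z) ^ 2 := by
  have hI' := hI.deriv Metric.isOpen_ball
  have hF' := hF.deriv Metric.isOpen_ball
  have hdiag : ∀ z ∈ V, ∑ j : Fin 6,
      (![deriv F, fun z => -2 * (deriv F z * I z), fun z => deriv F z * I z ^ 2,
        fun z => -deriv I z, fun z => 2 * (deriv I z * F z),
        fun z => -(deriv I z * F z ^ 2)] : Fin 6 → ℂ → ℂ) j z *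
      starRingEnd ℂ ((![deriv F, fun z => deriv F z * I z, fun z => deriv F z * I z ^ 2,
        deriv I, fun z => deriv I z * F z, fun z => deriv I z * F z ^ 2] : Fin 6 → ℂ → ℂ) j z) =
      0 := by
    intro z hz
    have h1 := congrArg (fun x : ℝ => ((x ^ 2 : ℝ) : ℂ)) (h z hz)
    have n : ∀ x : ℂ, ((‖x‖ : ℝ) : ℂ) ^ 2 = x * starRingEnd ℂ x := fun x => by
      rw [Complex.mul_conj, ← Complex.sq_norm]; push_cast; rfl
    push_cast at h1
    rw [mul_pow, mul_pow, n, n, n, n] at h1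
    simp [Fin.sum_univ_six]
    linear_combination h1
  intro z hz
  have := sum_mul_conj_eq_zero_of_diagonal hV hVD (by
      intro j; fin_cases j <;> simp <;> fun_prop) (by
      intro j; fin_cases j <;> simp <;> fun_prop) hdiag hw z hz
  simp [Fin.sum_univ_six] at this
  linear_combination this

/-- Two holomorphic self-maps of the disk that pull back the Poincaré metric to the same metric
near a point where it does not degenerate differ by an automorphism. -/
theorem exists_automorphism_of_norm_eq {I F : ℂ → ℂ} (hI : DifferentiableOn ℂ I unitDisk)
    (hIm : MapsTo I unitDisk unitDisk) (hF : DifferentiableOn ℂ F unitDisk)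
    (hFm : MapsTo F unitDisk unitDisk) {V : Set ℂ} (hV : IsOpen V) (hVD : V ⊆ unitDisk)
    (h : ∀ z ∈ V, ‖deriv F z‖ * (1 - ‖I z‖ ^ 2) = ‖deriv I z‖ * (1 - ‖F z‖ ^ 2)) {w : ℂ}
    (hw : w ∈ V) (hIw : deriv I w ≠ 0) :
    ∃ σ : ℂ → ℂ, IsDiskAutomorphism σ ∧ ∀ z ∈ unitDisk, F z = σ (I z) := by
  have hwD := hVD hw
  have hpol := deriv_mul_conj_eq_of_norm_eq hI hF hV hVD h hw
  have ha := hIm hwD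
  have hb := hFm hwD
  have hea : ∀ x : ℂ, starRingEnd ℂ x * x = ((‖x‖ ^ 2 : ℝ) : ℂ) := fun x => by
    rw [mul_comm, Complex.mul_conj, ← Complex.sq_norm]
  have hpos : ∀ {x : ℂ}, x ∈ unitDisk → 0 < 1 - ‖x‖ ^ 2 := fun {x} hx => by
    rw [Complex.sq_norm]
    exact sub_pos.mpr (normSq_lt_one_of_mem_unitDisk hx)
  have hFw : deriv F w ≠ 0 := by
    intro h0
    have h1 := h w hw
    rw [h0, norm_zero, zero_mul] at h1
    exact (mul_pos (norm_pos_iff.mpr hIw) (hpos hb)).ne h1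
  set c : ℂ := starRingEnd ℂ (deriv I w) * (1 - starRingEnd ℂ (F w) * F w) /
    (starRingEnd ℂ (deriv F w) * (1 - starRingEnd ℂ (I w) * I w)) with hc
  have hIw0 := one_sub_conj_mul_ne_zero ha ha
  have hFw0 := one_sub_conj_mul_ne_zero hb hb
  have hFw' : starRingEnd ℂ (deriv F w) ≠ 0 := (map_ne_zero _).mpr hFw
  have hcn : ‖c‖ = 1 := by
    have hn : ∀ {x : ℂ}, x ∈ unitDisk → ‖1 - starRingEnd ℂ x * x‖ = 1 - ‖x‖ ^ 2 := fun {x} hx => by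
      rw [hea, ← Complex.ofReal_one, ← Complex.ofReal_sub, Complex.norm_real, Real.norm_eq_abs,
        abs_of_pos (hpos hx)]
    rw [hc, norm_div, norm_mul, norm_mul, hn ha, hn hb, Complex.norm_conj, Complex.norm_conj,
      h w hw, div_self]
    exact (mul_pos (norm_pos_iff.mpr hIw) (hpos hb)).ne'
  -- The normalised maps have proportional derivatives and a common zero.
  have hprop : ∀ z ∈ unitDisk, diskMobius (F w) (F z) = c * diskMobius (I w) (I z) := by
    have hd : ∀ z ∈ unitDisk, HasDerivAt
        (fun z => diskMobius (F w) (F z) - c * diskMobius (I w) (I z)) 0 z := by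
      intro z hz
      have h1 := hasDerivAt_diskMobius_comp
        (hF.differentiableAt (Metric.isOpen_ball.mem_nhds hz)) hb (hFm hz)
      have h2 := hasDerivAt_diskMobius_comp
        (hI.differentiableAt (Metric.isOpen_ball.mem_nhds hz)) ha (hIm hz)
      refine (h1.sub (h2.const_mul c)).congr_deriv ?_
      have h3 := one_sub_conj_mul_ne_zero hb (hFm hz)
      have h4 := one_sub_conj_mul_ne_zero ha (hIm hz)
      have h5 := hpol z hz
      rw [hc, sub_eq_zero]
      field_simp
      linear_combination h5
    intro z hz
    have := Metric.isOpen_ball.is_const_of_deriv_eq_zero (convex_ball (0 : ℂ) 1).isPreconnected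
      (fun z hz => (hd z hz).differentiableAt.differentiableWithinAt)
      (fun z hz => (hd z hz).deriv) hz hwD
    simp only [diskMobius, sub_self, zero_div, mul_zero] at this
    exact sub_eq_zero.mp this
  refine ⟨diskMobius (-F w) ∘ (fun x => c * x) ∘ diskMobius (I w),
    (isDiskAutomorphism_diskMobius (neg_mem_unitDisk hb)).comp
      ((isDiskAutomorphism_mul hcn).comp (isDiskAutomorphism_diskMobius ha)), fun z hz => ?_⟩
  simp only [Function.comp_apply]
  rw [← hprop z hz, diskMobius_neg_diskMobius hb (hFm hz)]

/-! ### Liouville maps of the canonical solution -/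

lemma isLiouvilleMap_self {I : ℂ → ℂ} (hI : DifferentiableOn ℂ I unitDisk)
    (hI1 : ∀ z ∈ unitDisk, ‖I z‖ < 1) :
    IsLiouvilleMap (deriv I) (fun z => Real.log (2 / (1 - ‖I z‖ ^ 2))) I := by
  refine ⟨hI, fun z hz => by rw [mem_ball_zero_iff]; exact hI1 z hz, fun z _ h => h,
    fun z _ h => ?_⟩
  have h0 := norm_ne_zero_iff.mpr h
  congr 1
  field_simp

/-- Comparing the two expressions of the solution shows that a Liouville map pulls back the
Poincaré metric to the same metric as `I`, off the zeros of `I'`. -/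
lemma IsLiouvilleMap.norm_deriv_mul_eq {I F : ℂ → ℂ} (hI1 : ∀ z ∈ unitDisk, ‖I z‖ < 1)
    (hF : IsLiouvilleMap (deriv I) (fun z => Real.log (2 / (1 - ‖I z‖ ^ 2))) F) {z : ℂ}
    (hz : z ∈ unitDisk) (hd : deriv I z ≠ 0) :
    ‖deriv F z‖ * (1 - ‖I z‖ ^ 2) = ‖deriv I z‖ * (1 - ‖F z‖ ^ 2) := by
  have hpos : ∀ {x : ℂ}, ‖x‖ < 1 → 0 < 1 - ‖x‖ ^ 2 := fun {x} hx =>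
    sub_pos.mpr (pow_lt_one₀ (norm_nonneg _) hx (by norm_num))
  have h1 := hpos (hI1 z hz)
  have h2 := hpos (mem_ball_zero_iff.mp (hF.mapsTo hz))
  have h3 := norm_pos_iff.mpr hd
  have h4 := norm_pos_iff.mpr (hF.deriv_ne_zero z hz hd)
  have h5 := Real.log_injOn_pos (mem_Ioi.mpr (by positivity)) (mem_Ioi.mpr (by positivity))
    (hF.eq_log z hz hd)
  field_simp at h5
  linarith

theorem mainTheorem6 (I : ℂ → ℂ) (hI : IsInnerFunction I)
    (hnc : ¬ ∃ c : ℂ, ∀ z ∈ unitDisk, I z = c) :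
    -- `I'` is a nonzero element of the weighted Bergman space
    (MemBergman (deriv I) ∧ ∃ z ∈ unitDisk, deriv I z ≠ 0) ∧
    -- `u_{I',n}` is well defined
    (∀ n : ℝ, ∃ u : ℂ → ℝ, ContinuousOn u unitDisk ∧
      IsDirichletSolution (deriv I) (fun _ => n) u ∧
      ∀ v : ℂ → ℝ, IsDirichletSolution (deriv I) (fun _ => n) v →
        v =ᵐ[volume.restrict unitDisk] u) ∧
    -- the canonical solution is `log (2 / (1 - |I|²))`
    (∀ z ∈ unitDisk, ‖I z‖ < 1) ∧
    IsWeakSolution (deriv I) (fun z => Real.log (2 / (1 - ‖I z‖ ^ 2))) ∧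
    IsCanonicalSolution (deriv I) (fun z => Real.log (2 / (1 - ‖I z‖ ^ 2))) ∧
    (∀ u : ℂ → ℝ, IsCanonicalSolution (deriv I) u →
      ∀ z ∈ unitDisk, u z = Real.log (2 / (1 - ‖I z‖ ^ 2))) ∧
    -- its Liouville map is `I`, which is unique up to automorphisms of the disk
    IsLiouvilleMap (deriv I) (fun z => Real.log (2 / (1 - ‖I z‖ ^ 2))) I ∧
    (∀ F : ℂ → ℂ, IsLiouvilleMap (deriv I) (fun z => Real.log (2 / (1 - ‖I z‖ ^ 2))) F →
      ∃ σ : ℂ → ℂ, IsDiskAutomorphism σ ∧ ∀ z ∈ unitDisk, F z = σ (I z)) := by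
  have hI1 := norm_lt_one_of_not_const hI hnc
  obtain ⟨w, hw, hIw⟩ := exists_deriv_ne_zero_of_not_const hI.holo hnc
  have hsol := isDirichletSolution_pullbackSolution hI hI1
  have hcont := continuousOn_pullbackSolution hI hI1
  refine ⟨⟨memBergman_deriv hI.holo hI1, w, hw, hIw⟩,
    fun n => ⟨_, hcont n, hsol n, fun v hv => hv.ae_eq (hsol n)⟩, hI1, ?_,
    ⟨_, fun n => ⟨hcont n, hsol n⟩, fun z hz => tendsto_pullbackSolution hI1 hz⟩, ?_,
    isLiouvilleMap_self hI.holo hI1, fun F hF => ?_⟩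
  · have h := isWeakSolution_pullbackSolution hI.holo hI1 one_pos le_rfl
    have e : pullbackSolution I 1 = fun z => Real.log (2 / (1 - ‖I z‖ ^ 2)) := by
      ext z; simp [pullbackSolution]
    rwa [e] at h
  · rintro u ⟨U, hU, hlim⟩ z hz
    refine tendsto_nhds_unique (hlim z hz) ((tendsto_pullbackSolution hI1 hz).congr fun n => ?_)
    exact (hsol n).eqOn (hU n).2 (hcont n) (hU n).1 hz
  · set V : Set ℂ := unitDisk ∩ {z | deriv I z ≠ 0} with hV
    have hVo : IsOpen V := (continuousOn_deriv_unitDisk hI.holo).isOpen_inter_preimage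
      Metric.isOpen_ball isOpen_ne
    exact exists_automorphism_of_norm_eq hI.holo
      (fun z hz => mem_ball_zero_iff.mpr (hI1 z hz)) hF.holo hF.mapsTo hVo inter_subset_left
      (fun z hz => hF.norm_deriv_mul_eq hI1 hz.1 hz.2) ⟨hw, hIw⟩ hIw
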